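/- Let $N=m^3$ with $m\ge 1$ an integer, and let $f:\{0,1\}^N\to\{0,1\}$ be the AND of $N^{1/3}=m$ ORs of $N^{2/3}=m^2$ variables each (all $N$ variables distinct). A quantum query algorithm with $T$ queries on input $x\in\{0,1\}^N$ applies $U_TO_xU_{T-1}O_x\cdots O_xU_0$ to a fixed basis state and then measures in the computational basis. Here the state space is finite-dimensional with basis states $|j,b,z\rangle$ ($j$ an index of a variable, $b\in\{0,1\}$, $z$ in a finite workspace), the unitaries $U_i$ do not depend on $x$, and $O_x|j,b,z\rangle=|j,b\oplus x_j,z\rangle$. Let $Q_0(f)$ be the least $T$ for which some algorithm with $T$ queries, with outputs $0$, $1$ or "don't know", on every input $x$ outputs "don't know" with probability at most $1/2$ and never outputs $1-f(x)$. Let $Q_0^{\mathrm{cert}}(f)$ be the self-certifying version: the least value of $T+k$ for which some quantum algorithm with $T$ queries always outputs a set of at most $k$ variables and, on every input $x$, with probability at least $1/2$ this set is a certificate, i.e. the values in $x$ of its variables force the value of $f$ (the $k$ accounts for classically querying these variables to verify the certificate). Let $R_2(f)$ be the least $T$ for which some probability distribution over deterministic decision trees of depth at most $T$ gives the answer $f(x)$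 with probability at least $2/3$ on every input $x$. Then $Q_0(f)=\Theta(N^{2/3})$, also $Q_0^{\mathrm{cert}}(f)=\Theta(N^{2/3})$, and $R_2(f)=\Omega(N)$. That is, there are absolute constants $c,C>0$ such that for all such $N$ $$c\,N^{2/3}\le Q_0(f)\le C\,N^{2/3},\qquad c\,N^{2/3}\le Q_0^{\mathrm{cert}}(f)\le C\,N^{2/3},\qquad R_2(f)\ge c\,N .$$ -/

import Mathlib

open scoped Matrix

/-- A quantum query algorithm for inputs `x : ι → Bool`, with measurement outcomes in `R`.
The state space has the orthonormal basis `|j, b, z⟩`, where `j : ι` is the index register,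
`b : Bool` is the query target qubit and `z : W` is a finite workspace.
The algorithm is `U_T O U_{T-1} O ⋯ O U_1 O U_0` with `T = queries`, run on a fixed basis state;
only `U 0, …, U T` are used, and they do not depend on `x`.
At the end the state is measured in the basis, and the outcome `s` is reported as `output s`. -/
structure QuantumQueryAlgorithm (ι : Type) [Fintype ι] [DecidableEq ι] (R : Type) where
  W : Type
  [fintypeW : Fintype W]
  [decidableEqW : DecidableEq W]
  queries : ℕ
  U : ℕ → Matrix.unitaryGroup (ι × Bool × W) ℂ
  init : ι × Bool × W
  output : ι × Bool × W → R

attribute [instance] QuantumQueryAlgorithm.fintypeW QuantumQueryAlgorithm.decidableEqW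

/-- The query gate `|j, b, z⟩ ↦ |j, b ⊕ x_j, z⟩`. -/
def queryGate {ι W : Type} [DecidableEq ι] [DecidableEq W] (x : ι → Bool) :
    Matrix (ι × Bool × W) (ι × Bool × W) ℂ :=
  Matrix.of fun s t => if s = (t.1, xor t.2.1 (x t.1), t.2.2) then 1 else 0

namespace QuantumQueryAlgorithm

variable {ι : Type} [Fintype ι] [DecidableEq ι] {R : Type}

/-- The state `U_k O ⋯ O U_0 |init⟩` on the input `x`. -/
noncomputable def stateAfter (A : QuantumQueryAlgorithm ι R) (x : ι → Bool) :
    ℕ → (ι × Bool × A.W → ℂ)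
  | 0 => (A.U 0 : Matrix (ι × Bool × A.W) (ι × Bool × A.W) ℂ) *ᵥ Pi.single A.init 1
  | k + 1 => (A.U (k + 1) : Matrix (ι × Bool × A.W) (ι × Bool × A.W) ℂ) *ᵥ
      (queryGate x *ᵥ A.stateAfter x k)

/-- The probability that on the input `x` the reported outcome lies in `E`. -/
noncomputable def prob (A : QuantumQueryAlgorithm ι R) (x : ι → Bool) (E : Set R) : ℝ :=
  ∑ s, (A.output ⁻¹' E).indicator (fun s => ‖A.stateAfter x A.queries s‖ ^ 2) s

/-- Zero-error computation of `f`: on every input the answer 'don't know' (`none`) has probability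
at most `1/2`, and the wrong answer is never given. -/
def ZeroError (A : QuantumQueryAlgorithm ι (Option Bool)) (f : (ι → Bool) → Bool) : Prop :=
  ∀ x, A.prob x {none} ≤ 1 / 2 ∧ A.prob x {some (!f x)} = 0

end QuantumQueryAlgorithm

/-- `S` is a certificate for `f` at `x`: the values of the variables in `S` force the value of
`f`. -/
def IsCertificate {ι : Type} (f : (ι → Bool) → Bool) (x : ι → Bool) (S : Finset ι) : Prop :=
  ∀ y : ι → Bool, (∀ i ∈ S, y i = x i) → f y = f x

/-- `A` outputs a set of at most `k` variables, which on every input is with probability at least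
`1/2` a certificate. (Querying the variables of the set classically, with at most `k` further
queries, decides whether it is a certificate and, if so, gives the value of `f`.) -/
def QuantumQueryAlgorithm.SelfCertifying {ι : Type} [Fintype ι] [DecidableEq ι]
    (A : QuantumQueryAlgorithm ι (Finset ι)) (f : (ι → Bool) → Bool) (k : ℕ) : Prop :=
  (∀ s, (A.output s).card ≤ k) ∧ ∀ x, 1 / 2 ≤ A.prob x {S | IsCertificate f x S}

/-- The zero-error quantum query complexity `Q_0(f)`. -/
noncomputable def zeroErrorQuantumComplexity {ι : Type} [Fintype ι] [DecidableEq ι]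
    (f : (ι → Bool) → Bool) : ℕ :=
  sInf {T | ∃ A : QuantumQueryAlgorithm ι (Option Bool), A.ZeroError f ∧ A.queries = T}

/-- The complexity `Q_0(f)` for self-certifying quantum algorithms: the queries of the quantum
algorithm that searches for a certificate plus those of the classical verification. -/
noncomputable def selfCertifyingQuantumComplexity {ι : Type} [Fintype ι] [DecidableEq ι]
    (f : (ι → Bool) → Bool) : ℕ :=
  sInf {T | ∃ (A : QuantumQueryAlgorithm ι (Finset ι)) (k : ℕ),
    A.SelfCertifying f k ∧ A.queries + k = T}

/-- Deterministic classical query algorithms; `query i t₀ t₁` queries `x i` and continues with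
`t₀` if the answer is `0` and with `t₁` if it is `1`. -/
inductive DecisionTree (ι : Type) : Type where
  | leaf : Bool → DecisionTree ι
  | query : ι → DecisionTree ι → DecisionTree ι → DecisionTree ι

namespace DecisionTree

variable {ι : Type}

/-- The answer on the input `x`. -/
def eval : DecisionTree ι → (ι → Bool) → Bool
  | leaf b, _ => b
  | query i t₀ t₁, x => if x i then t₁.eval x else t₀.eval x

/-- The number of queries on a worst-case input. -/
def depth : DecisionTree ι → ℕ
  | leaf _ => 0
  | query _ t₀ t₁ => max t₀.depth t₁.depth + 1

end DecisionTree

/-- The bounded-error classical query complexity `R_2(f)`: the least `T` such that some probability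
distribution on decision trees of depth at most `T` gives the correct answer with probability at
least `2/3` on every input. -/
noncomputable def boundedErrorClassicalComplexity {ι : Type} (f : (ι → Bool) → Bool) : ℕ :=
  sInf {T | ∃ p : PMF (DecisionTree ι), (∀ t ∈ p.support, t.depth ≤ T) ∧
    ∀ x, 2 / 3 ≤ p.map (fun t => t.eval x) (f x)}

/-- The AND of `a` ORs of `b` variables each, all variables distinct. -/
def andOfOrs (a b : ℕ) (x : Fin a × Fin b → Bool) : Bool :=
  decide (∀ i, ∃ j, x (i, j) = true)

/-! Write `a` for the number of blocks and `b` for their size; in the end `a = m`, `b = m ^ 2`.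

Classical bound: take the hard inputs with a single one, at a random place, in every block. Erasing
the one of block `i` flips the value, and a tree that never queried this one answers the same on
both inputs. A tree that is right with probability `2/3` on both must therefore find the one of an
average block with probability at least `1/3`. Finding a uniformly placed item among `b` costs `(b +
1) / 2` queries on average (`sum_card_found_le`), so the depth is at least `a * (b + 1) / 6`.

Quantum lower bounds: with all other blocks set to one, the function is the OR of `b` bits. The
probability of the answer 0 is then a polynomial of degree at most `2 * T` in these bits that
vanishes except at the zero input. Such a point function has a nonzero top Fourier coefficient,
hence degree `b` (`le_queries_of_zeroError`). For self-certifying algorithms, a certificate of the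
zero input already contains a whole block (`le_of_selfCertifying`).

Quantum upper bounds: search for a one in some block not yet hit with Grover's algorithm, whose odd
multiple `2 * r + 1` of the angle runs cyclically through `1, 3, 9, …, 3 ^ M` with `3 ^ M` of order
`m`. For a block with a one, some level of each cycle succeeds with probability at least `1/16`, so
a cycle costs `O(m)` queries and makes constant progress. The budget of `44 * m` cycles is shared by
all the blocks, which avoids a logarithmic factor; the supermartingale `potential` shows that with
probability at least `1/2` the search ends with all blocks hit or stuck at a block without ones
(`exists_search`). Either outcome contains a certificate: one found position per block, or the whole
stuck block, which is read with `m ^ 2` further queries.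

The measurements between the attempts are replaced by copying each result to a fresh memory slot
that later unitaries only use as a control (`Reach.record`). -/

/-! ### Decision trees and the variables they query. -/

namespace DecisionTree

variable {ι : Type}

/-- The variable `i` is queried on the input `x`. -/
def Queries : DecisionTree ι → (ι → Bool) → ι → Prop
  | leaf _, _, _ => False
  | query k t₀ t₁, x, i => k = i ∨ if x k then t₁.Queries x i else t₀.Queries x i

theorem eval_update_of_not_queries [DecidableEq ι] (t : DecisionTree ι) (x : ι → Bool) (i : ι)
    (v : Bool) (h : ¬ t.Queries x i) : t.eval (Function.update x i v) = t.eval x := by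
  induction t with
  | leaf b => rfl
  | query k t₀ t₁ h₀ h₁ =>
    simp only [Queries, not_or] at h
    have hk : Function.update x i v k = x k := Function.update_of_ne h.1 _ _
    simp only [eval, hk]
    by_cases hx : x k = true
    · simp only [hx, if_true] at h ⊢
      exact h₁ h.2
    · simp only [hx] at h ⊢
      exact h₀ h.2

/-- Every function of finitely many variables is computed by a decision tree. -/
theorem exists_eval_eq [Finite ι] (f : (ι → Bool) → Bool) :
    ∃ t : DecisionTree ι, ∀ x, t.eval x = f x := by
  classical
  have := Fintype.ofFinite ι
  suffices H : ∀ (S : Finset ι) (f : (ι → Bool) → Bool),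
      (∀ x y, (∀ i ∈ S, x i = y i) → f x = f y) → ∃ t : DecisionTree ι, ∀ x, t.eval x = f x from
    H Finset.univ f fun x y h => congrArg f (funext fun i => h i (Finset.mem_univ i))
  intro S
  induction S using Finset.induction_on with
  | empty =>
    intro f hf
    exact ⟨leaf (f fun _ => false), fun x => hf _ _ (by simp)⟩
  | insert k S hk ih =>
    intro f hf
    have key : ∀ v : Bool, ∃ t : DecisionTree ι, ∀ x, t.eval x = f (Function.update x k v) := by
      intro v
      refine ih _ fun x y hxy => hf _ _ fun i hi => ?_
      by_cases hik : i = k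
      · subst hik; simp
      · rw [Function.update_of_ne hik, Function.update_of_ne hik]
        exact hxy i ((Finset.mem_insert.1 hi).resolve_left hik)
    obtain ⟨t₀, h₀⟩ := key false
    obtain ⟨t₁, h₁⟩ := key true
    refine ⟨query k t₀ t₁, fun x => ?_⟩
    simp only [eval, h₀, h₁]
    split_ifs with hx
    · rw [← hx, Function.update_eq_self]
    · rw [← Bool.eq_false_of_not_eq_true hx, Function.update_eq_self]

end DecisionTree

/-! ### The classical lower bound. -/

/-- The input with exactly one `1` in each block, at the position `c i` of the block `i`. -/
def oneInput {a b : ℕ} (c : Fin a → Fin b) (p : Fin a × Fin b) : Bool :=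
  decide (c p.1 = p.2)

theorem andOfOrs_oneInput {a b : ℕ} (c : Fin a → Fin b) : andOfOrs a b (oneInput c) = true := by
  simp [andOfOrs, oneInput]

theorem andOfOrs_update_oneInput {a b : ℕ} (c : Fin a → Fin b) (i : Fin a) :
    andOfOrs a b (Function.update (oneInput c) (i, c i) false) = false := by
  simp only [andOfOrs, decide_eq_false_iff_not, not_forall, not_exists]
  refine ⟨i, fun j => ?_⟩
  by_cases h : j = c i
  · subst h; simp
  · rw [Function.update_of_ne (by simpa using h)]
    simpa [oneInput] using Ne.symm h

open Classical in
/-- On a product set of inputs, a tree of depth `d` finds few of the ones. -/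
theorem sum_card_found_le {a b : ℕ} (t : DecisionTree (Fin a × Fin b)) :
    ∀ (S : Fin a → Finset (Fin b)) (K : Finset (Fin a)),
    (∑ c ∈ Fintype.piFinset S,
      ((K.filter fun i => t.Queries (oneInput c) (i, c i)).card : ℝ)) * (b + 1) ≤
    ((Fintype.piFinset S).card : ℝ) * (2 * t.depth + ∑ i ∈ K, ((b : ℝ) - (S i).card)) := by
  have hpos : ∀ (S : Fin a → Finset (Fin b)) (K : Finset (Fin a)),
      0 ≤ ∑ i ∈ K, ((b : ℝ) - (S i).card) := fun S K => Finset.sum_nonneg fun i _ => by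
    have := Finset.card_le_univ (S i)
    rw [Fintype.card_fin] at this
    have : ((S i).card : ℝ) ≤ b := by exact_mod_cast this
    linarith
  -- The bound is an amortization: each found block is charged `b + 1`, each query pays `2`, and `b
  -- - (S i).card` is the credit of the places of block `i` already excluded. General product sets
  -- are needed because the branches restrict `c`.
  induction t with
  | leaf v =>
    intro S K
    have h0 : ∀ c : Fin a → Fin b,
        (K.filter fun i => (DecisionTree.leaf v).Queries (oneInput c) (i, c i)) = ∅ := fun c =>
      Finset.filter_eq_empty_iff.2 fun _ _ h => h
    simp only [h0, Finset.card_empty, Nat.cast_zero, Finset.sum_const_zero, zero_mul,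
      DecisionTree.depth, mul_zero, zero_add]
    exact mul_nonneg (Nat.cast_nonneg _) (hpos S K)
  | query k t₀ t₁ h₀ h₁ =>
    obtain ⟨i, j⟩ := k
    intro S K
    set d : ℝ := ((DecisionTree.query (i, j) t₀ t₁).depth : ℝ) with hd
    have hd₀ : (t₀.depth : ℝ) + 1 ≤ d := by
      rw [hd]; exact_mod_cast Nat.succ_le_succ (le_max_left _ _)
    have hd₁ : (t₁.depth : ℝ) + 1 ≤ d := by
      rw [hd]; exact_mod_cast Nat.succ_le_succ (le_max_right _ _)
    set F : (Fin a → Fin b) → ℝ := fun c => ((K.filter fun i' =>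
      (DecisionTree.query (i, j) t₀ t₁).Queries (oneInput c) (i', c i')).card : ℝ) with hF
    -- the two parts of the product set
    set S₀ := Function.update S i ((S i).erase j) with hS₀
    set S₁ := Function.update S i ({j} : Finset (Fin b)) with hS₁
    have hF₀ : ∀ c, c i ≠ j →
        F c = ((K.filter fun i' => t₀.Queries (oneInput c) (i', c i')).card : ℝ) := by
      intro c hc
      simp only [hF]
      congr 2
      ext i'
      simp only [DecisionTree.Queries, oneInput, hc, Finset.mem_filter]
      simp only [Prod.mk.injEq, decide_false, Bool.false_eq_true, if_false]
      constructor
      · rintro ⟨h1, ⟨rfl, h2⟩ | h2⟩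
        · exact absurd h2.symm hc
        · exact ⟨h1, h2⟩
      · rintro ⟨h1, h2⟩; exact ⟨h1, Or.inr h2⟩
    -- Once the one of block `i` is found, the block is counted and leaves `K`, together with its
    -- credit.
    have hF₁ : ∀ c, c i = j → F c ≤ (if i ∈ K then 1 else 0) +
        (((K.erase i).filter fun i' => t₁.Queries (oneInput c) (i', c i')).card : ℝ) := by
      intro c hc
      have hsub : (K.filter fun i' =>
          (DecisionTree.query (i, j) t₀ t₁).Queries (oneInput c) (i', c i')) ⊆
          (if i ∈ K then {i} else ∅) ∪
            ((K.erase i).filter fun i' => t₁.Queries (oneInput c) (i', c i')) := by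
        intro i' hi'
        simp only [DecisionTree.Queries, oneInput, hc, Finset.mem_filter, Prod.mk.injEq,
          decide_true, if_true] at hi'
        by_cases h : i' = i
        · subst h; simp [hi'.1]
        · rcases hi'.2 with h2 | h2
          · exact absurd h2.1.symm h
          · exact Finset.mem_union_right _
              (Finset.mem_filter.2 ⟨Finset.mem_erase.2 ⟨h, hi'.1⟩, h2⟩)
      have h3 := (Finset.card_le_card hsub).trans (Finset.card_union_le _ _)
      have h4 : (if i ∈ K then {i} else ∅ : Finset (Fin a)).card = if i ∈ K then 1 else 0 := by
        split_ifs <;> simp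
      rw [h4] at h3
      have h5 : F c ≤ (((if i ∈ K then 1 else 0) + ((K.erase i).filter fun i' =>
          t₁.Queries (oneInput c) (i', c i')).card : ℕ) : ℝ) := Nat.cast_le.2 h3
      simpa using h5
    have hb : (0 : ℝ) ≤ b + 1 := by positivity
    -- If `j ∉ S i`, the answer 0 is known in advance and the query is wasted.
    by_cases hj : j ∈ S i
    swap
    · have hc : ∀ c ∈ Fintype.piFinset S, c i ≠ j := fun c hc h =>
        hj (h ▸ Fintype.mem_piFinset.1 hc i)
      rw [Finset.sum_congr rfl fun c h => hF₀ c (hc c h)]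
      refine (h₀ S K).trans (mul_le_mul_of_nonneg_left ?_ (Nat.cast_nonneg _))
      linarith
    have hsplit : Fintype.piFinset S = Fintype.piFinset S₁ ∪ Fintype.piFinset S₀ := by
      ext c
      simp only [Finset.mem_union, Fintype.mem_piFinset, hS₁, hS₀]
      constructor
      · intro h
        by_cases hc : c i = j
        · left; intro i'
          by_cases hi : i' = i
          · subst hi; simp [hc]
          · rw [Function.update_of_ne hi]; exact h i'
        · right; intro i'
          by_cases hi : i' = i
          · subst hi; simp [hc, h]
          · rw [Function.update_of_ne hi]; exact h i'
      · rintro (h | h) i'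
        · have := h i'
          by_cases hi : i' = i
          · subst hi; simp only [Function.update_self, Finset.mem_singleton] at this
            rwa [this]
          · rwa [Function.update_of_ne hi] at this
        · have := h i'
          by_cases hi : i' = i
          · subst hi; rw [Function.update_self] at this
            exact Finset.mem_of_mem_erase this
          · rwa [Function.update_of_ne hi] at this
    have hc₁ : ∀ c ∈ Fintype.piFinset S₁, c i = j := fun c hc => by
      simpa [hS₁] using Fintype.mem_piFinset.1 hc i
    have hc₀ : ∀ c ∈ Fintype.piFinset S₀, c i ≠ j := fun c hc => by
      have := Fintype.mem_piFinset.1 hc i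
      rw [hS₀, Function.update_self] at this
      exact Finset.ne_of_mem_erase this
    have hdisj : Disjoint (Fintype.piFinset S₁) (Fintype.piFinset S₀) :=
      Finset.disjoint_left.2 fun c h1 h2 => hc₀ c h2 (hc₁ c h1)
    set P : ℝ := ∏ i' ∈ Finset.univ \ {i}, ((S i').card : ℝ) with hP
    have hPpos : 0 ≤ P := Finset.prod_nonneg fun _ _ => Nat.cast_nonneg _
    have hcard : ∀ A : Finset (Fin b),
        ((Fintype.piFinset (Function.update S i A)).card : ℝ) = A.card * P := by
      intro A
      rw [Fintype.card_piFinset]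
      push_cast
      rw [hP, ← Finset.prod_update_of_mem (Finset.mem_univ i) (fun i' => ((S i').card : ℝ))]
      refine Finset.prod_congr rfl fun i' _ => ?_
      by_cases hi : i' = i
      · subst hi; simp
      · simp [Function.update_of_ne hi]
    have hcS : ((Fintype.piFinset S).card : ℝ) = (S i).card * P := by
      rw [← hcard, Function.update_eq_self]
    have hs1 : (1 : ℝ) ≤ (S i).card := by
      exact_mod_cast Finset.card_pos.2 ⟨j, hj⟩
    have her : (((S i).erase j).card : ℝ) = (S i).card - 1 := by
      rw [Finset.card_erase_of_mem hj, Nat.cast_sub (Finset.card_pos.2 ⟨j, hj⟩), Nat.cast_one]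
    set s : ℝ := ((S i).card : ℝ) with hs
    set U : ℝ := ∑ i' ∈ K.erase i, ((b : ℝ) - (S i').card) with hU
    have hUpos : 0 ≤ U := hpos S _
    have hU' : ∀ A, ∑ i' ∈ K.erase i, ((b : ℝ) - (Function.update S i A i').card) = U := fun A =>
      Finset.sum_congr rfl fun i' hi' => by
        rw [Function.update_of_ne (Finset.ne_of_mem_erase hi')]
    have I₁ := h₁ S₁ (K.erase i)
    have I₀ := h₀ S₀ K
    rw [hS₁, hcard, hU', Finset.card_singleton, Nat.cast_one, one_mul, ← hS₁] at I₁
    rw [hsplit, Finset.sum_union hdisj, ← hsplit, hcS, Finset.sum_congr rfl fun c h => hF₀ c (hc₀ c h)]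
    have J₁ : ∑ c ∈ Fintype.piFinset S₁, F c ≤ P * (if i ∈ K then 1 else 0) +
        ∑ c ∈ Fintype.piFinset S₁,
          (((K.erase i).filter fun i' => t₁.Queries (oneInput c) (i', c i')).card : ℝ) := by
      refine (Finset.sum_le_sum fun c h => hF₁ c (hc₁ c h)).trans_eq ?_
      rw [Finset.sum_add_distrib, Finset.sum_const, nsmul_eq_mul, hS₁, hcard]
      simp
    have J₁' := mul_le_mul_of_nonneg_right J₁ hb
    rw [add_mul] at J₁' ⊢
    have m1 := mul_le_mul_of_nonneg_left hd₁ hPpos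
    have m0 := mul_le_mul_of_nonneg_left hd₀ (mul_nonneg (sub_nonneg.2 hs1) hPpos)
    by_cases hi : i ∈ K
    · rw [if_pos hi] at J₁'
      rw [← Finset.add_sum_erase K _ hi, hS₀, hU', hcard, Function.update_self, her, ← hS₀] at I₀
      rw [← Finset.add_sum_erase K _ hi, ← hU, ← hs]
      -- With `s = (S i).card` this rests on the identity `(b + 1) + (s - 1) * (b - s + 1) = 2 * s +
      -- s * (b - s)`, so nothing is lost in this case.
      nlinarith
    · have hK : K.erase i = K := Finset.erase_eq_of_notMem hi
      rw [if_neg hi] at J₁'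
      rw [hK] at hU' hU
      rw [hS₀, hU', hcard, her, ← hS₀] at I₀
      rw [← hU]
      nlinarith [mul_nonneg (mul_nonneg hPpos hUpos) (by linarith : (0:ℝ) ≤ s), mul_nonneg hPpos (by linarith : (0:ℝ) ≤ s)]

/-- Averaged over the one-inputs `c` and the erased blocks `i`, a shallow tree is right on
few more than one of the two inputs `c` and `c` with the block `i` erased. -/
theorem sum_correct_le {a b T : ℕ} (hb : 0 < b) (t : DecisionTree (Fin a × Fin b))
    (ht : t.depth ≤ T) :
    ((∑ c : Fin a → Fin b, ∑ i : Fin a, ((if true = t.eval (oneInput c) then 1 else 0) +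
      (if false = t.eval (Function.update (oneInput c) (i, c i) false) then 1 else 0)) : ℕ) : ℝ) ≤
    (b : ℝ) ^ a * (a + 2 * T / (b + 1)) := by
  classical
  have key := sum_card_found_le t (fun _ => Finset.univ) Finset.univ
  have hb' : (0 : ℝ) < b + 1 := by positivity
  simp only [Finset.card_univ, Fintype.card_fin, sub_self, Finset.sum_const_zero, add_zero,
    Fintype.piFinset_univ, Fintype.card_fun, Nat.cast_pow] at key
  rw [← le_div_iff₀ hb'] at key
  have hle : ∀ (c : Fin a → Fin b), (∑ i : Fin a,
      ((if true = t.eval (oneInput c) then 1 else 0) +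
      (if false = t.eval (Function.update (oneInput c) (i, c i) false) then 1 else 0)) : ℕ) ≤
      a + (Finset.univ.filter fun i => t.Queries (oneInput c) (i, c i)).card := by
    intro c
    -- Without a query to `(i, c i)` both inputs get the same answer, and exactly one of the two is
    -- answered correctly.
    have : ∀ i : Fin a, ((if true = t.eval (oneInput c) then 1 else 0) +
        (if false = t.eval (Function.update (oneInput c) (i, c i) false) then 1 else 0) : ℕ) ≤
        1 + if t.Queries (oneInput c) (i, c i) then 1 else 0 := by
      intro i
      by_cases h : t.Queries (oneInput c) (i, c i)
      · rw [if_pos h]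
        split_ifs <;> simp
      · rw [t.eval_update_of_not_queries _ _ _ h]
        cases t.eval (oneInput c) <;> simp
    refine (Finset.sum_le_sum fun i _ => this i).trans_eq ?_
    rw [Finset.sum_add_distrib, Finset.card_filter]
    simp
  have h1 : ((∑ c : Fin a → Fin b, (a + (Finset.univ.filter fun i =>
      t.Queries (oneInput c) (i, c i)).card) : ℕ) : ℝ) ≤ (b : ℝ) ^ a * (a + 2 * T / (b + 1)) := by
    push_cast
    rw [Finset.sum_add_distrib]
    simp only [Finset.sum_const, Finset.card_univ, Fintype.card_fun, Fintype.card_fin,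
      nsmul_eq_mul, Nat.cast_pow]
    rw [mul_add]
    refine add_le_add_right (key.trans ?_) _
    rw [mul_div_assoc]
    have : (t.depth : ℝ) ≤ T := by exact_mod_cast ht
    gcongr
  exact le_trans (by exact_mod_cast Finset.sum_le_sum fun c _ => hle c) h1

/-- The two success probabilities of a pair add up to at least `4/3`, while a tree earns on average
at most `1 + 2 * T / (a * (b + 1))` per pair. The difference `1/3` gives the constant `6`. -/
theorem le_depth_of_correct {a b T : ℕ} (hb : 0 < b) (p : PMF (DecisionTree (Fin a × Fin b)))
    (hT : ∀ t ∈ p.support, t.depth ≤ T)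
    (hp : ∀ x, 2 / 3 ≤ p.map (fun t => t.eval x) (andOfOrs a b x)) :
    (a : ℝ) * (b + 1) ≤ 6 * T := by
  classical
  set Nt : DecisionTree (Fin a × Fin b) → ℕ := fun t =>
    ∑ c : Fin a → Fin b, ∑ i : Fin a, ((if true = t.eval (oneInput c) then 1 else 0) +
      (if false = t.eval (Function.update (oneInput c) (i, c i) false) then 1 else 0)) with hNt
  set B : ℝ := (b : ℝ) ^ a * (a + 2 * T / (b + 1)) with hB
  have hB0 : 0 ≤ B := by positivity
  have upper : ∑' t, p t * (Nt t : ENNReal) ≤ ENNReal.ofReal B := by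
    calc ∑' t, p t * (Nt t : ENNReal) ≤ ∑' t, p t * ENNReal.ofReal B := by
          refine ENNReal.tsum_le_tsum fun t => ?_
          by_cases h : p t = 0
          · simp [h]
          · refine mul_le_mul_right ?_ _
            rw [← ENNReal.ofReal_natCast]
            exact ENNReal.ofReal_le_ofReal (sum_correct_le hb t (hT t ((p.mem_support_iff t).2 h)))
      _ = ENNReal.ofReal B := by rw [ENNReal.tsum_mul_right, p.tsum_coe, one_mul]
  have lower : ∑ c : Fin a → Fin b, ∑ i : Fin a, ((2 / 3 : ENNReal) + 2 / 3) ≤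
      ∑' t, p t * (Nt t : ENNReal) := by
    have h1 : ∀ (c : Fin a → Fin b) (i : Fin a), (2 / 3 : ENNReal) + 2 / 3 ≤
        ∑' t, p t * (((if true = t.eval (oneInput c) then 1 else 0) +
      (if false = t.eval (Function.update (oneInput c) (i, c i) false) then 1 else 0) : ℕ) :
        ENNReal) := by
      intro c i
      have e1 := hp (oneInput c)
      have e2 := hp (Function.update (oneInput c) (i, c i) false)
      rw [andOfOrs_oneInput, PMF.map_apply] at e1
      rw [andOfOrs_update_oneInput, PMF.map_apply] at e2
      refine (add_le_add e1 e2).trans_eq ?_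
      rw [← ENNReal.tsum_add]
      refine tsum_congr fun t => ?_
      push_cast
      rw [mul_add, mul_ite, mul_ite, mul_one, mul_zero]
      congr
    calc _ ≤ _ := Finset.sum_le_sum fun c _ => Finset.sum_le_sum fun i _ => h1 c i
      _ = _ := by
        simp only [← Summable.tsum_finsetSum fun _ _ => ENNReal.summable, ← Finset.mul_sum]
        refine tsum_congr fun t => ?_
        rw [hNt]
        push_cast
        rfl
  have h := lower.trans upper
  have h43 : ∑ c : Fin a → Fin b, ∑ i : Fin a, ((2 / 3 : ENNReal) + 2 / 3) =
      ENNReal.ofReal ((b : ℝ) ^ a * (a * (4 / 3))) := by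
    have e : (2 / 3 : ENNReal) + 2 / 3 = ENNReal.ofReal (4 / 3) := by
      rw [show (4 / 3 : ℝ) = 2 / 3 + 2 / 3 by norm_num,
        ENNReal.ofReal_add (by norm_num) (by norm_num), ENNReal.ofReal_div_of_pos (by norm_num)]
      simp
    rw [e, ENNReal.ofReal_mul (by positivity), ENNReal.ofReal_mul (by positivity)]
    simp [ENNReal.ofReal_pow]
  rw [h43, ENNReal.ofReal_le_ofReal_iff hB0, hB] at h
  have hb1 : (0 : ℝ) < (b : ℝ) ^ a := by positivity
  have h2 := le_of_mul_le_mul_left h hb1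
  have hb' : (0 : ℝ) < b + 1 := by positivity
  have h3 : (a : ℝ) * (1 / 3) ≤ 2 * T / (b + 1) := by linarith
  rw [le_div_iff₀ hb'] at h3
  linarith

theorem boundedErrorClassicalComplexity_andOfOrs_ge {a b : ℕ} (hb : 0 < b) :
    (a : ℝ) * (b + 1) ≤ 6 * boundedErrorClassicalComplexity (andOfOrs a b) := by
  -- Nonemptiness matters: the infimum of the empty set of naturals would be `0`.
  have hne : {T | ∃ p : PMF (DecisionTree (Fin a × Fin b)), (∀ t ∈ p.support, t.depth ≤ T) ∧
      ∀ x, 2 / 3 ≤ p.map (fun t => t.eval x) (andOfOrs a b x)}.Nonempty := by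
    obtain ⟨t, ht⟩ := DecisionTree.exists_eval_eq (andOfOrs a b)
    refine ⟨t.depth, PMF.pure t, fun s hs => ?_, fun x => ?_⟩
    · rw [PMF.support_pure, Set.mem_singleton_iff] at hs
      rw [hs]
    · rw [PMF.pure_map, ht, PMF.pure_apply_self]
      exact ENNReal.div_le_of_le_mul (by norm_num)
  obtain ⟨p, hT, hp⟩ := Nat.sInf_mem hne
  exact le_depth_of_correct hb p hT hp

/-! ### The query gate and preservation of the norm. -/

theorem queryGate_mulVec {ι W : Type} [Fintype ι] [DecidableEq ι] [Fintype W] [DecidableEq W]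
    (x : ι → Bool) (ψ : ι × Bool × W → ℂ) (s : ι × Bool × W) :
    (queryGate x *ᵥ ψ) s = ψ (s.1, xor s.2.1 (x s.1), s.2.2) := by
  rw [Matrix.mulVec, dotProduct, Finset.sum_eq_single (s.1, xor s.2.1 (x s.1), s.2.2)]
  · simp [queryGate]
  · rintro ⟨j, b, z⟩ - h
    rw [queryGate, Matrix.of_apply, if_neg, zero_mul]
    rintro rfl
    simp at h
  · simp

theorem sum_norm_sq_mulVec_unitary {n : Type} [Fintype n] [DecidableEq n]
    (U : Matrix.unitaryGroup n ℂ) (ψ : n → ℂ) :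
    ∑ s, ‖((U : Matrix n n ℂ) *ᵥ ψ) s‖ ^ 2 = ∑ s, ‖ψ s‖ ^ 2 := by
  have h : ∀ φ : n → ℂ, ((∑ s, ‖φ s‖ ^ 2 : ℝ) : ℂ) = star φ ⬝ᵥ φ := by
    intro φ
    simp only [dotProduct, Pi.star_apply, RCLike.star_def, Complex.conj_mul', Complex.ofReal_sum,
      Complex.ofReal_pow]
  have h2 : star (U : Matrix n n ℂ) * U = 1 := Matrix.UnitaryGroup.star_mul_self U
  apply Complex.ofReal_injective
  rw [h, h, Matrix.star_mulVec, ← Matrix.dotProduct_mulVec, Matrix.mulVec_mulVec,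
    ← Matrix.star_eq_conjTranspose, h2, Matrix.one_mulVec]

theorem sum_norm_sq_queryGate_mulVec {ι W : Type} [Fintype ι] [DecidableEq ι] [Fintype W]
    [DecidableEq W] (x : ι → Bool) (ψ : ι × Bool × W → ℂ) :
    ∑ s, ‖(queryGate x *ᵥ ψ) s‖ ^ 2 = ∑ s, ‖ψ s‖ ^ 2 := by
  simp only [queryGate_mulVec]
  refine Equiv.sum_comp (Function.Involutive.toPerm
    (fun s : ι × Bool × W => (s.1, xor s.2.1 (x s.1), s.2.2)) fun s => ?_) fun s => ‖ψ s‖ ^ 2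
  simp

/-! ### The polynomial method. -/

/-- Linear combinations of functions of at most `d` of the variables. -/
def juntaSpan (n : Type) (d : ℕ) : Submodule ℂ ((n → Bool) → ℂ) :=
  Submodule.span ℂ {g | ∃ S : Finset n, S.card ≤ d ∧ ∀ y z, (∀ i ∈ S, y i = z i) → g y = g z}

section juntaSpan

variable {n : Type}

theorem mul_mem_juntaSpan {d e : ℕ} {g h : (n → Bool) → ℂ} (hg : g ∈ juntaSpan n d)
    (hh : h ∈ juntaSpan n e) : g * h ∈ juntaSpan n (d + e) := by
  classical
  have := Submodule.mul_mem_mul hg hh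
  rw [juntaSpan, juntaSpan, Submodule.span_mul_span] at this
  refine Submodule.span_mono ?_ this
  rintro _ ⟨g, ⟨S, hS, hg⟩, h, ⟨S', hS', hh⟩, rfl⟩
  refine ⟨S ∪ S', (Finset.card_union_le _ _).trans (add_le_add hS hS'), fun y z hyz => ?_⟩
  simp only [Pi.mul_apply]
  rw [hg y z fun i hi => hyz i (Finset.mem_union_left _ hi),
    hh y z fun i hi => hyz i (Finset.mem_union_right _ hi)]

theorem const_mem_juntaSpan {d : ℕ} (c : ℂ) : (fun _ => c) ∈ juntaSpan n d :=
  Submodule.subset_span ⟨∅, by simp, fun _ _ _ => rfl⟩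

theorem conj_mem_juntaSpan {d : ℕ} {g : (n → Bool) → ℂ} (hg : g ∈ juntaSpan n d) :
    (fun y => (starRingEnd ℂ) (g y)) ∈ juntaSpan n d := by
  induction hg using Submodule.span_induction with
  | mem g hg =>
    obtain ⟨S, hS, h⟩ := hg
    exact Submodule.subset_span ⟨S, hS, fun y z hyz => congrArg _ (h y z hyz)⟩
  | zero =>
    simp only [Pi.zero_apply, map_zero]
    exact (juntaSpan n d).zero_mem
  | add g h _ _ hg hh =>
    simp only [Pi.add_apply, map_add]
    exact (juntaSpan n d).add_mem hg hh
  | smul c g _ hg =>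
    simp only [Pi.smul_apply, smul_eq_mul, map_mul]
    exact (juntaSpan n d).smul_mem ((starRingEnd ℂ) c) hg

/-- A junta on fewer than all variables ignores some `k`; flipping `k` changes the parity sign only,
so the terms cancel in pairs. -/
theorem sum_sign_mul_eq_zero [Fintype n] [DecidableEq n] {d : ℕ} (hd : d < Fintype.card n)
    {g : (n → Bool) → ℂ} (hg : g ∈ juntaSpan n d) :
    ∑ y : n → Bool, (∏ i, if y i then (-1 : ℂ) else 1) * g y = 0 := by
  induction hg using Submodule.span_induction with
  | mem g hg =>
    obtain ⟨S, hS, h⟩ := hg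
    obtain ⟨k, hk⟩ : ∃ k, k ∉ S := by
      by_contra! hall
      rw [← Finset.card_univ, ← Finset.eq_univ_of_forall hall] at hd
      omega
    refine Finset.sum_involution (fun y _ => Function.update y k (!y k)) ?_ ?_ ?_ ?_
    · intro y _
      rw [h (Function.update y k (!y k)) y fun i hi =>
        Function.update_of_ne (ne_of_mem_of_not_mem hi hk) _ _, ← add_mul]
      rw [← Finset.mul_prod_erase _ _ (Finset.mem_univ k),
        ← Finset.mul_prod_erase _ _ (Finset.mem_univ k)]
      have hprod : ∏ i ∈ Finset.univ.erase k,
          (if Function.update y k (!y k) i then (-1 : ℂ) else 1) =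
          ∏ i ∈ Finset.univ.erase k, if y i then (-1 : ℂ) else 1 :=
        Finset.prod_congr rfl fun i hi => by
          rw [Function.update_of_ne (Finset.ne_of_mem_erase hi)]
      rw [hprod, Function.update_self]
      cases y k <;> simp
    · intro y _ _ he
      have := congrFun he k
      simp at this
    · simp
    · intro y _
      simp
  | zero => simp
  | add g h _ _ hg hh => simp only [Pi.add_apply, mul_add, Finset.sum_add_distrib, hg, hh, add_zero]
  | smul c g _ hg =>
    simp only [Pi.smul_apply, smul_eq_mul, mul_left_comm _ c, ← Finset.mul_sum, hg, mul_zero]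

end juntaSpan

namespace QuantumQueryAlgorithm

variable {ι : Type} [Fintype ι] [DecidableEq ι] {R : Type}

theorem sum_norm_sq_stateAfter (A : QuantumQueryAlgorithm ι R) (x : ι → Bool) (k : ℕ) :
    ∑ s, ‖A.stateAfter x k s‖ ^ 2 = 1 := by
  induction k with
  | zero =>
    rw [stateAfter, sum_norm_sq_mulVec_unitary, Finset.sum_eq_single A.init]
    · simp
    · intro s _ hs; simp [hs]
    · simp
  | succ k ih => rw [stateAfter, sum_norm_sq_mulVec_unitary, sum_norm_sq_queryGate_mulVec, ih]

/-- When every queried variable is a variable `y i` or a constant, the amplitudes after `k`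
queries are linear combinations of functions of at most `k` of the `y i`. -/
theorem stateAfter_mem_juntaSpan (A : QuantumQueryAlgorithm ι R) {n : Type}
    (X : (n → Bool) → ι → Bool) (hX : ∀ j, ∃ S : Finset n, S.card ≤ 1 ∧
      ∀ y z, (∀ i ∈ S, y i = z i) → X y j = X z j) (k : ℕ) :
    ∀ s, (fun y => A.stateAfter (X y) k s) ∈ juntaSpan n k := by
  induction k with
  | zero => exact fun s => const_mem_juntaSpan _
  | succ k ih =>
    intro s
    have hq : ∀ t, (fun y => (queryGate (X y) *ᵥ A.stateAfter (X y) k) t) ∈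
        juntaSpan n (k + 1) := by
      rintro ⟨j, b, z⟩
      obtain ⟨S, hS, hj⟩ := hX j
      have hind : ∀ v : Bool, (fun y => if X y j = v then (1 : ℂ) else 0) ∈ juntaSpan n 1 :=
        fun v => Submodule.subset_span ⟨S, hS, fun y z h => by
          simp only [hj y z h]⟩
      -- The new amplitude is a sum over the two values of the queried bit, each old amplitude being
      -- multiplied by an indicator of degree one.
      have := (juntaSpan n (k + 1)).add_mem
        (mul_mem_juntaSpan (ih (j, xor b true, z)) (hind true))
        (mul_mem_juntaSpan (ih (j, xor b false, z)) (hind false))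
      refine (congrArg (· ∈ juntaSpan n (k + 1)) (funext fun y => ?_)).mp this
      rw [queryGate_mulVec]
      simp only [Pi.add_apply, Pi.mul_apply]
      cases hy : X y j <;> simp
    have : (fun y => A.stateAfter (X y) (k + 1) s) =
        ∑ t, (A.U (k + 1) : Matrix (ι × Bool × A.W) (ι × Bool × A.W) ℂ) s t •
          fun y => (queryGate (X y) *ᵥ A.stateAfter (X y) k) t := by
      funext y
      rw [Finset.sum_apply]
      rfl
    rw [this]
    exact Submodule.sum_mem _ fun t _ => Submodule.smul_mem _ _ (hq t)

/-- A probability is a sum of amplitudes times their conjugates, which doubles the degree. -/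
theorem prob_mem_juntaSpan (A : QuantumQueryAlgorithm ι R) {n : Type}
    (X : (n → Bool) → ι → Bool) (hX : ∀ j, ∃ S : Finset n, S.card ≤ 1 ∧
      ∀ y z, (∀ i ∈ S, y i = z i) → X y j = X z j) (E : Set R) :
    (fun y => (A.prob (X y) E : ℂ)) ∈ juntaSpan n (A.queries + A.queries) := by
  classical
  have : (fun y => (A.prob (X y) E : ℂ)) = ∑ s, (if A.output s ∈ E then (1 : ℂ) else 0) •
      ((fun y => (starRingEnd ℂ) (A.stateAfter (X y) A.queries s)) *
        fun y => A.stateAfter (X y) A.queries s) := by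
    funext y
    rw [Finset.sum_apply, prob, Complex.ofReal_sum]
    refine Finset.sum_congr rfl fun s _ => ?_
    by_cases h : A.output s ∈ E
    · rw [Set.indicator_of_mem (show s ∈ A.output ⁻¹' E from h)]
      simp [h, Complex.conj_mul']
    · rw [Set.indicator_of_notMem (show s ∉ A.output ⁻¹' E from h)]
      simp [h]
  rw [this]
  refine Submodule.sum_mem _ fun s _ => Submodule.smul_mem _ _ ?_
  have hs := A.stateAfter_mem_juntaSpan X hX A.queries s
  exact mul_mem_juntaSpan (conj_mem_juntaSpan hs) hs

theorem ZeroError.one_half_le_prob {A : QuantumQueryAlgorithm ι (Option Bool)}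
    {f : (ι → Bool) → Bool} (h : A.ZeroError f) (x : ι → Bool) : 1 / 2 ≤ A.prob x {some (f x)} := by
  classical
  have hsum : A.prob x {none} + A.prob x {some (!f x)} + A.prob x {some (f x)} = 1 := by
    rw [← A.sum_norm_sq_stateAfter x A.queries, prob, prob, prob, ← Finset.sum_add_distrib,
      ← Finset.sum_add_distrib]
    refine Finset.sum_congr rfl fun s _ => ?_
    simp only [Set.indicator, Set.mem_preimage, Set.mem_singleton_iff]
    rcases A.output s with _ | v
    · simp
    · cases v <;> cases f x <;> simp
  have := h x
  linarith

end QuantumQueryAlgorithm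

/-! ### The quantum lower bounds. -/

/-- If the degree `2 * T` were below `b`, the parity sum of the probability of the answer 0 would
vanish. By zero error only the all-zero point contributes to it, and there the probability is at
least `1/2`. -/
theorem le_queries_of_zeroError {a b : ℕ} (ha : 0 < a) (hb : 0 < b)
    (A : QuantumQueryAlgorithm (Fin a × Fin b) (Option Bool)) (hA : A.ZeroError (andOfOrs a b)) :
    b ≤ 2 * A.queries := by
  classical
  by_contra! hlt
  set X : (Fin b → Bool) → Fin a × Fin b → Bool :=
    fun y p => if p.1 = ⟨0, ha⟩ then y p.2 else true
  have hX : ∀ p, ∃ S : Finset (Fin b), S.card ≤ 1 ∧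
      ∀ y z, (∀ i ∈ S, y i = z i) → X y p = X z p := fun p =>
    ⟨{p.2}, by simp, fun y z h => by simp [X, h p.2 (by simp)]⟩
  have hf : ∀ y, andOfOrs a b (X y) = decide (∃ j, y j = true) := by
    intro y
    rw [andOfOrs, decide_eq_decide]
    constructor
    · intro h
      simpa [X] using h ⟨0, ha⟩
    · rintro ⟨j, hj⟩ i
      by_cases hi : i = ⟨0, ha⟩
      · exact ⟨j, by simp [X, hi, hj]⟩
      · exact ⟨⟨0, hb⟩, by simp [X, hi]⟩
  clear_value X
  have h0 := sum_sign_mul_eq_zero (d := A.queries + A.queries)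
    (by rw [Fintype.card_fin]; omega) (A.prob_mem_juntaSpan X hX {some false})
  rw [Finset.sum_eq_single (fun _ => false)] at h0
  · have h1 := hA.one_half_le_prob (X fun _ => false)
    rw [hf] at h1
    simp at h0 h1
    rw [h0] at h1
    norm_num at h1
  · intro y _ hy
    have hy' : ∃ j, y j = true := by
      by_contra! hall
      exact hy (funext fun j => by simpa using hall j)
    have h2 := (hA (X y)).2
    rw [hf, decide_eq_true hy'] at h2
    simp only [Bool.not_true] at h2
    rw [h2]
    simp
  · simp

theorem le_of_selfCertifying {a b k : ℕ} (ha : 0 < a)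
    (A : QuantumQueryAlgorithm (Fin a × Fin b) (Finset (Fin a × Fin b)))
    (hA : A.SelfCertifying (andOfOrs a b) k) : b ≤ k := by
  classical
  have h := hA.2 fun _ => false
  obtain ⟨s, hs⟩ : ∃ s, IsCertificate (andOfOrs a b) (fun _ => false) (A.output s) := by
    by_contra! hall
    rw [QuantumQueryAlgorithm.prob, Finset.sum_eq_zero fun s _ =>
      Set.indicator_of_notMem (hall s) _] at h
    norm_num at h
  refine le_trans ?_ (hA.1 s)
  by_contra! hlt
  have hall : ∀ i : Fin a, ∃ j : Fin b, (i, j) ∉ A.output s := by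
    intro i
    by_contra! hi
    have := Finset.card_le_card (s := Finset.univ.image fun j : Fin b => (i, j))
      (t := A.output s) fun p hp => by
        obtain ⟨j, -, rfl⟩ := Finset.mem_image.1 hp
        exact hi j
    rw [Finset.card_image_of_injective _ (Prod.mk_right_injective i), Finset.card_univ,
      Fintype.card_fin] at this
    omega
  -- A set that misses a position in every block cannot tell the zero input from the input that is
  -- one exactly off the set.
  have h1 := hs (fun p => decide (p ∉ A.output s)) fun p hp => by simpa using hp
  have h2 : andOfOrs a b (fun p => decide (p ∉ A.output s)) = true := by
    simpa [andOfOrs] using hall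
  have h3 : andOfOrs a b (fun _ => false) = false := by
    simpa [andOfOrs] using ⟨⟨0, ha⟩⟩
  rw [h2, h3] at h1
  exact Bool.noConfusion h1

/-! ### Unitary building blocks. -/

section Unitaries

variable {n o : Type} [Fintype n] [DecidableEq n] [Fintype o] [DecidableEq o]

/-- The unitary that applies `u k` to the first register when the second one holds `k`. -/
def controlledUnitary (u : o → Matrix.unitaryGroup n ℂ) : Matrix.unitaryGroup (n × o) ℂ :=
  ⟨Matrix.blockDiagonal fun k => (u k : Matrix n n ℂ), by
    rw [Matrix.mem_unitaryGroup_iff, Matrix.star_eq_conjTranspose,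
      Matrix.blockDiagonal_conjTranspose, ← Matrix.blockDiagonal_mul, ← Matrix.blockDiagonal_one]
    congr 1
    funext k
    exact Matrix.mem_unitaryGroup_iff.1 (u k).2⟩

theorem controlledUnitary_mulVec (u : o → Matrix.unitaryGroup n ℂ) (ψ : n × o → ℂ) (s : n × o) :
    ((controlledUnitary u : Matrix (n × o) (n × o) ℂ) *ᵥ ψ) s =
      ((u s.2 : Matrix n n ℂ) *ᵥ fun j => ψ (j, s.2)) s.1 := by
  simp only [Matrix.mulVec, dotProduct, controlledUnitary, Fintype.sum_prod_type,
    Matrix.blockDiagonal_apply, ite_mul, zero_mul]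
  refine Finset.sum_congr rfl fun j _ => ?_
  rw [Finset.sum_ite_eq]
  simp

/-- The unitary that permutes the basis states by `σ`. -/
def permUnitary (σ : Equiv.Perm n) : Matrix.unitaryGroup n ℂ :=
  ⟨σ.permMatrix ℂ, by
    rw [Matrix.mem_unitaryGroup_iff, Matrix.star_eq_conjTranspose, Matrix.conjTranspose_permMatrix,
      ← Matrix.permMatrix_mul]
    simp⟩

theorem permUnitary_mulVec (σ : Equiv.Perm n) (ψ : n → ℂ) (s : n) :
    ((permUnitary σ : Matrix n n ℂ) *ᵥ ψ) s = ψ (σ s) := by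
  rw [permUnitary, Matrix.permMatrix_mulVec]
  rfl

/-- The reflection in the hyperplane orthogonal to the real vector `w`. -/
noncomputable def reflectionUnitary (w : n → ℝ) : Matrix.unitaryGroup n ℂ :=
  ⟨(1 - (2 / (w ⬝ᵥ w)) • Matrix.vecMulVec w w : Matrix n n ℝ).map Complex.ofReal, by
    have h : (1 - (2 / (w ⬝ᵥ w)) • Matrix.vecMulVec w w : Matrix n n ℝ) *
        (1 - (2 / (w ⬝ᵥ w)) • Matrix.vecMulVec w w) = 1 := by
      -- For `w = 0` the division by zero gives the identity, which is still unitary.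
      by_cases hw : w ⬝ᵥ w = 0
      · simp [hw]
      · rw [sub_mul, one_mul, mul_sub, mul_one, Matrix.smul_mul, Matrix.mul_smul,
          Matrix.vecMulVec_mul_vecMulVec, Matrix.vecMulVec_smul, smul_smul, smul_smul]
        have : 2 / (w ⬝ᵥ w) * (2 / (w ⬝ᵥ w) * (w ⬝ᵥ w)) = 2 / (w ⬝ᵥ w) + 2 / (w ⬝ᵥ w) := by
          field_simp; ring
        rw [mul_assoc, this, add_smul]
        abel
    have ht : star ((1 - (2 / (w ⬝ᵥ w)) • Matrix.vecMulVec w w : Matrix n n ℝ).map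
        Complex.ofReal) = (1 - (2 / (w ⬝ᵥ w)) • Matrix.vecMulVec w w : Matrix n n ℝ).map
        Complex.ofReal := by
      ext i j
      simp only [Matrix.star_apply, Matrix.map_apply, RCLike.star_def, Complex.conj_ofReal,
        Matrix.sub_apply, Matrix.smul_apply, Matrix.vecMulVec_apply, Matrix.one_apply,
        eq_comm (a := i), mul_comm (w i)]
    rw [Matrix.mem_unitaryGroup_iff, ht]
    have := congrArg (fun A : Matrix n n ℝ => A.map Complex.ofRealHom) h
    simp only [Matrix.map_mul, Matrix.map_one _ (map_zero Complex.ofRealHom)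
      (map_one Complex.ofRealHom)] at this
    exact this⟩

theorem reflectionUnitary_mulVec (w v : n → ℝ) (a : ℂ) (j : n) :
    ((reflectionUnitary w : Matrix n n ℂ) *ᵥ fun j => a * (v j : ℂ)) j =
      a * ((v j - 2 * (w ⬝ᵥ v) / (w ⬝ᵥ w) * w j : ℝ) : ℂ) := by
  have h : ((1 - (2 / (w ⬝ᵥ w)) • Matrix.vecMulVec w w : Matrix n n ℝ) *ᵥ v) j =
      v j - 2 * (w ⬝ᵥ v) / (w ⬝ᵥ w) * w j := by
    rw [Matrix.sub_mulVec, Matrix.one_mulVec, Matrix.smul_mulVec, Matrix.vecMulVec_mulVec]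
    simp only [Pi.sub_apply, Pi.smul_apply, smul_eq_mul, MulOpposite.smul_eq_mul_unop,
      MulOpposite.unop_op]
    ring
  rw [← h]
  simp only [reflectionUnitary, Matrix.mulVec, dotProduct, Matrix.map_apply, Complex.ofReal_sum,
    Complex.ofReal_mul, Finset.mul_sum]
  exact Finset.sum_congr rfl fun k _ => by ring

/-- The Householder reflection along `e - s` exchanges the unit vectors `e` and `s`; it supplies
state preparation without completing bases. -/
theorem reflectionUnitary_sub_mulVec {e s : n → ℝ} (he : e ⬝ᵥ e = 1) (hs : s ⬝ᵥ s = 1) (a : ℂ)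
    (j : n) :
    ((reflectionUnitary (e - s) : Matrix n n ℂ) *ᵥ fun j => a * (e j : ℂ)) j = a * (s j : ℂ) := by
  rw [reflectionUnitary_mulVec]
  have h1 : (e - s) ⬝ᵥ e = 1 - e ⬝ᵥ s := by rw [sub_dotProduct, he, dotProduct_comm s]
  have h2 : (e - s) ⬝ᵥ (e - s) = 2 * (1 - e ⬝ᵥ s) := by
    rw [sub_dotProduct, dotProduct_sub, dotProduct_sub, he, hs, dotProduct_comm s]; ring
  by_cases h : 1 - e ⬝ᵥ s = 0
  · rw [h, mul_zero] at h2
    have := congrFun (dotProduct_self_eq_zero.1 h2) j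
    rw [Pi.sub_apply, Pi.zero_apply, sub_eq_zero] at this
    rw [Pi.sub_apply, this]; simp
  · rw [h1, h2, div_self (mul_ne_zero two_ne_zero h), Pi.sub_apply]
    congr 2
    ring

end Unitaries

/-! ### Composing algorithms from gates, with deferred measurements. -/

section Reach

/-- The register is `0` in its second component and the index has the amplitudes `a z * g z j`. -/
def productState {ι W : Type} (a : W → ℂ) (g : W → ι → ℝ) (s : ι × Bool × W) : ℂ :=
  if s.2.1 then 0 else a s.2.2 * (g s.2.2 s.1 : ℂ)

/-- The weight `Φ` makes this an expectation over the memory contents; it serves for norms, output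
probabilities and the potential. -/
theorem sum_norm_sq_productState {ι W : Type} [Fintype ι] [Fintype W]
    (a : W → ℂ) (g : W → ι → ℝ) (Φ : W → ℝ) :
    ∑ s, ‖productState a g s‖ ^ 2 * Φ s.2.2 = ∑ z, ‖a z‖ ^ 2 * (∑ j, g z j ^ 2) * Φ z := by
  simp only [Fintype.sum_prod_type, productState, Fintype.sum_bool]
  simp only [Finset.sum_add_distrib, if_true, norm_zero, Bool.false_eq_true, if_false, norm_mul, Complex.norm_real,
    mul_pow, Real.norm_eq_abs, sq_abs]
  simp only [ne_eq, OfNat.ofNat_ne_zero, not_false_eq_true, zero_pow, zero_mul,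
    Finset.sum_const_zero, zero_add]
  rw [Finset.sum_comm]
  refine Finset.sum_congr rfl fun z _ => ?_
  rw [Finset.mul_sum, Finset.sum_mul]

/-- The exchange of the query register with the memory slot `k`. -/
def swapSlot {ι K : Type} [DecidableEq K] (k : K) : Equiv.Perm (ι × Bool × (K → ι × Bool)) where
  toFun s := ((s.2.2 k).1, (s.2.2 k).2, Function.update s.2.2 k (s.1, s.2.1))
  invFun s := ((s.2.2 k).1, (s.2.2 k).2, Function.update s.2.2 k (s.1, s.2.1))
  left_inv s := by simp
  right_inv s := by simp

theorem swapSlot_apply {ι K : Type} [DecidableEq K] (k : K) (s : ι × Bool × (K → ι × Bool)) :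
    swapSlot k s = ((s.2.2 k).1, (s.2.2 k).2, Function.update s.2.2 k (s.1, s.2.1)) := rfl

theorem swapSlot_swapSlot {ι K : Type} [DecidableEq K] (k : K) (s : ι × Bool × (K → ι × Bool)) :
    swapSlot k (swapSlot k s) = s :=
  (swapSlot k).left_inv s

variable {ι W : Type} [Fintype ι] [DecidableEq ι] [Fintype W] [DecidableEq W]

/-- `Reach s₀ T ψ`: from the basis state `s₀`, with `T` queries and with unitaries that do not
depend on the input, one gets to the state `ψ x` on each input `x`. -/
inductive Reach (s₀ : ι × Bool × W) : ℕ → ((ι → Bool) → ι × Bool × W → ℂ) → Prop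
  | init : Reach s₀ 0 fun _ => Pi.single s₀ 1
  | unitary {T ψ} (U : Matrix.unitaryGroup (ι × Bool × W) ℂ) (h : Reach s₀ T ψ) :
      Reach s₀ T fun x => (U : Matrix (ι × Bool × W) (ι × Bool × W) ℂ) *ᵥ ψ x
  | query {T ψ} (h : Reach s₀ T ψ) : Reach s₀ (T + 1) fun x => queryGate x *ᵥ ψ x

theorem Reach.of_eq {s₀ : ι × Bool × W} {T T' : ℕ} {ψ ψ' : (ι → Bool) → ι × Bool × W → ℂ}
    (h : Reach s₀ T ψ) (hT : T = T') (hψ : ∀ x s, ψ x s = ψ' x s) : Reach s₀ T' ψ' := by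
  subst hT
  rwa [← (funext fun x => funext (hψ x) : ψ = ψ')]

/-- An algorithm alternates unitaries and queries, so a further unitary is multiplied into `U T`,
and a further query is followed by the identity. -/
theorem Reach.exists_algorithm {s₀ : ι × Bool × W} {T : ℕ} {ψ : (ι → Bool) → ι × Bool × W → ℂ}
    (h : Reach s₀ T ψ) {R : Type} (out : ι × Bool × W → R) :
    ∃ A : QuantumQueryAlgorithm ι R, A.queries = T ∧ (∀ s, ∃ t, A.output s = out t) ∧
      ∀ x E, A.prob x E = ∑ s, (out ⁻¹' E).indicator (fun s => ‖ψ x s‖ ^ 2) s := by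
  suffices H : ∃ U : ℕ → Matrix.unitaryGroup (ι × Bool × W) ℂ,
      ∀ x, QuantumQueryAlgorithm.stateAfter ⟨W, T, U, s₀, out⟩ x T = ψ x by
    obtain ⟨U, hU⟩ := H
    refine ⟨⟨W, T, U, s₀, out⟩, rfl, fun s => ⟨s, rfl⟩, fun x E => ?_⟩
    simp only [QuantumQueryAlgorithm.prob, hU]
  have congr_of : ∀ (T T' k : ℕ) (U U' : ℕ → Matrix.unitaryGroup (ι × Bool × W) ℂ) (x : ι → Bool),
      (∀ i ≤ k, U i = U' i) →
      QuantumQueryAlgorithm.stateAfter (⟨W, T, U, s₀, out⟩ : QuantumQueryAlgorithm ι R) x k =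
      QuantumQueryAlgorithm.stateAfter (⟨W, T', U', s₀, out⟩ : QuantumQueryAlgorithm ι R) x k := by
    intro T T' k U U' x
    induction k with
    | zero => intro h; simp only [QuantumQueryAlgorithm.stateAfter, h 0 le_rfl]
    | succ k ih =>
      intro h
      simp only [QuantumQueryAlgorithm.stateAfter, h (k + 1) le_rfl,
        ih fun i hi => h i (Nat.le_succ_of_le hi)]
  induction h with
  | init =>
    refine ⟨fun _ => 1, fun x => ?_⟩
    rw [QuantumQueryAlgorithm.stateAfter]
    exact Matrix.one_mulVec _
  | @unitary T ψ V h ih =>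
    obtain ⟨U, hU⟩ := ih
    refine ⟨Function.update U T (V * U T), fun x => ?_⟩
    simp only [← hU x]
    cases T with
    | zero =>
      simp only [QuantumQueryAlgorithm.stateAfter, Function.update_self, Submonoid.coe_mul,
        Matrix.mulVec_mulVec]
    | succ k =>
      simp only [QuantumQueryAlgorithm.stateAfter, Function.update_self, Submonoid.coe_mul,
        ← Matrix.mulVec_mulVec]
      rw [congr_of (k + 1) (k + 1) k (Function.update U (k + 1) (V * U (k + 1))) U x fun i hi =>
        Function.update_of_ne (by omega) _ _]
  | @query T ψ h ih =>
    obtain ⟨U, hU⟩ := ih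
    refine ⟨Function.update U (T + 1) 1, fun x => ?_⟩
    simp only [← hU x]
    simp only [QuantumQueryAlgorithm.stateAfter, Function.update_self]
    rw [congr_of (T + 1) T T (Function.update U (T + 1) 1) U x fun i hi =>
        Function.update_of_ne (by omega) _ _]
    simp

theorem Reach.sum_norm_sq {s₀ : ι × Bool × W} {T : ℕ} {ψ : (ι → Bool) → ι × Bool × W → ℂ}
    (h : Reach s₀ T ψ) (x : ι → Bool) : ∑ s, ‖ψ x s‖ ^ 2 = 1 := by
  induction h with
  | init =>
    rw [Finset.sum_eq_single s₀]
    · simp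
    · intro s _ hs; simp [hs]
    · simp
  | unitary U h ih => rw [sum_norm_sq_mulVec_unitary, ih]
  | query h ih => rw [sum_norm_sq_queryGate_mulVec, ih]

/-- The reflection is controlled by the memory `z`, so the reflecting vector may depend on earlier
results. -/
theorem Reach.reflection {s₀ : ι × Bool × W} {T : ℕ} {a : (ι → Bool) → W → ℂ}
    {g : (ι → Bool) → W → ι → ℝ} (h : Reach s₀ T fun x => productState (a x) (g x))
    (w : W → ι → ℝ) : Reach s₀ T fun x => productState (a x) fun z j =>
      g x z j - 2 * (w z ⬝ᵥ g x z) / (w z ⬝ᵥ w z) * w z j := by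
  refine (h.unitary (controlledUnitary fun k => reflectionUnitary (w k.2))).of_eq rfl fun x s => ?_
  rw [controlledUnitary_mulVec]
  by_cases hs : s.2.1 = true
  · simp only [productState, hs, if_true]
    exact congrFun (Matrix.mulVec_zero _) _
  · simp only [productState, hs]
    exact reflectionUnitary_mulVec _ _ _ _

theorem Reach.prepare {s₀ : ι × Bool × W} {T : ℕ} {a : (ι → Bool) → W → ℂ} {e s : W → ι → ℝ}
    (he : ∀ z, e z ⬝ᵥ e z = 1) (hs : ∀ z, s z ⬝ᵥ s z = 1)
    (h : Reach s₀ T fun x => productState (a x) e) :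
    Reach s₀ T fun x => productState (a x) s := by
  refine (h.unitary (controlledUnitary fun k => reflectionUnitary (e k.2 - s k.2))).of_eq rfl
    fun x t => ?_
  rw [controlledUnitary_mulVec]
  by_cases ht : t.2.1 = true
  · simp only [productState, ht, if_true]
    exact congrFun (Matrix.mulVec_zero _) _
  · simp only [productState, ht]
    exact reflectionUnitary_sub_mulVec (he _) (hs _) _ _

/-- Two queries suffice for a phase change by `-1` on the indices `j` with `x j = 0`. -/
theorem Reach.phase {s₀ : ι × Bool × W} {T : ℕ} {a : (ι → Bool) → W → ℂ}
    {g : (ι → Bool) → W → ι → ℝ} (h : Reach s₀ T fun x => productState (a x) (g x)) :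
    Reach s₀ (T + 2) fun x => productState (a x) fun z j => if x j then g x z j else -g x z j := by
  -- The second query uncomputes the target qubit after the sign has been applied to it.
  refine ((h.query.unitary
    (controlledUnitary fun k => if k.1 then 1 else -1)).query).of_eq rfl fun x s => ?_
  obtain ⟨j, b, z⟩ := s
  rw [queryGate_mulVec, controlledUnitary_mulVec]
  have hq : ∀ (b : Bool) (φ : ι → ℂ), ((if b then 1 else -1 : Matrix.unitaryGroup ι ℂ) :
      Matrix ι ι ℂ) *ᵥ φ = if b then φ else -φ := by
    intro b φ
    cases b
    swap
    · simp
    · exact (Matrix.neg_mulVec _ _).trans (congrArg _ (Matrix.one_mulVec _))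
  simp only [hq, queryGate_mulVec, productState]
  cases b <;> cases hx : x j <;> simp [hx]

/-- One query and a swap with a fresh memory slot `k` put a sampled index `j` and the value `x j`
into the slot `k`, and the query register is clean again. -/
theorem Reach.record {K : Type} [Fintype K] [DecidableEq K]
    {s₀ : ι × Bool × (K → ι × Bool)} {T : ℕ} {a : (ι → Bool) → (K → ι × Bool) → ℂ}
    {g : (ι → Bool) → (K → ι × Bool) → ι → ℝ} {j₀ : ι} (k : K)
    (hk : ∀ x h, a x h ≠ 0 → h k = (j₀, false))
    (hr : Reach s₀ T fun x => productState (a x) (g x)) :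
    ∃ a' : (ι → Bool) → (K → ι × Bool) → ℂ,
      Reach s₀ (T + 1) (fun x => productState (a' x) fun _ => Pi.single j₀ 1) ∧
      (∀ x h', a' x h' ≠ 0 → ∃ h j, a x h ≠ 0 ∧ g x h j ≠ 0 ∧ h' = Function.update h k (j, x j)) ∧
      ∀ x (Φ : (K → ι × Bool) → ℝ), ∑ h, ‖a' x h‖ ^ 2 * Φ h =
        ∑ h, ‖a x h‖ ^ 2 * ∑ j, g x h j ^ 2 * Φ (Function.update h k (j, x j)) := by
  set a' : (ι → Bool) → (K → ι × Bool) → ℂ := fun x h' =>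
    if (h' k).2 = x (h' k).1 then a x (Function.update h' k (j₀, false)) *
      (g x (Function.update h' k (j₀, false)) (h' k).1 : ℂ) else 0 with ha'
  have hstate : ∀ x s, productState (a' x) (fun _ => Pi.single j₀ 1) s =
      (queryGate x *ᵥ productState (a x) (g x)) (swapSlot k s) := by
    rintro x ⟨j, b, h⟩
    rw [queryGate_mulVec, swapSlot_apply]
    simp only [productState, ha']
    by_cases hc : (j, b) = (j₀, false)
    · obtain ⟨rfl, rfl⟩ := Prod.mk.inj hc
      rcases Bool.eq_false_or_eq_true (h k).2 with e | e <;>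
        rcases Bool.eq_false_or_eq_true (x (h k).1) with e' | e' <;> simp [e, e']
    · have h0 : a x (Function.update h k (j, b)) = 0 := by
        by_contra hne
        exact hc (by simpa using hk x _ hne)
      rw [h0, zero_mul, ite_self]
      cases b
      · have : j ≠ j₀ := fun e => hc (by rw [e])
        simp [this]
      · simp
  refine ⟨a', (hr.query.unitary (permUnitary (swapSlot k))).of_eq rfl fun x s => ?_, ?_, ?_⟩
  · rw [permUnitary_mulVec, hstate]
  · intro x h' hne
    simp only [ha'] at hne
    split_ifs at hne with hx
    · refine ⟨Function.update h' k (j₀, false), (h' k).1, left_ne_zero_of_mul hne,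
        fun e => right_ne_zero_of_mul hne (by rw [e]; rfl), ?_⟩
      rw [Function.update_idem, ← hx]
      simp
    · exact absurd rfl hne
  · intro x Φ
    have h1 := sum_norm_sq_productState (a' x) (fun _ => Pi.single j₀ 1) Φ
    have hs1 : ∑ j, (Pi.single j₀ (1 : ℝ) : ι → ℝ) j ^ 2 = 1 := by
      rw [Finset.sum_eq_single j₀] <;> simp +contextual
    simp only [hs1, mul_one] at h1
    rw [← h1]
    simp only [hstate]
    -- Undoing the swap inside the sum leaves the sampled `j` in the query register. Different `j`
    -- lead to orthogonal memories, so the probabilities add as for a measurement.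
    rw [← Equiv.sum_comp (swapSlot k)]
    simp only [swapSlot_swapSlot, queryGate_mulVec, Fintype.sum_prod_type, Fintype.sum_bool]
    rw [Finset.sum_congr rfl fun j _ => add_comm _ _]
    simp only [← Finset.sum_add_distrib]
    rw [Finset.sum_comm]
    refine Finset.sum_congr rfl fun h _ => ?_
    rw [Finset.mul_sum]
    refine Finset.sum_congr rfl fun j _ => ?_
    simp only [swapSlot_apply, productState]
    cases hx : x j <;> simp [mul_pow, mul_assoc]

end Reach

/-! ### Grover's search within one block. -/

section Grover

variable {a b : ℕ}

/-- The number of ones in the block `i`. -/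
def blockCount (x : Fin a × Fin b → Bool) (i : Fin a) : ℕ :=
  (Finset.univ.filter fun j => x (i, j) = true).card

/-- The angle whose sine is the root of the fraction of ones in the block `i`. -/
noncomputable def groverAngle (x : Fin a × Fin b → Bool) (i : Fin a) : ℝ :=
  Real.arcsin √(blockCount x i / b)

/-- The uniform superposition of the indices in the block `i`. -/
noncomputable def blockVec (i : Fin a) (p : Fin a × Fin b) : ℝ :=
  if p.1 = i then 1 / √b else 0

/-- The amplitudes after `r` iterations of Grover's search in the block `i`. -/
noncomputable def groverVec (x : Fin a × Fin b → Bool) (i : Fin a) (r : ℕ) (p : Fin a × Fin b) : ℝ :=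
  if p.1 = i then
    if x p then Real.sin ((2 * r + 1) * groverAngle x i) / (√b * Real.sin (groverAngle x i))
    else Real.cos ((2 * r + 1) * groverAngle x i) / (√b * Real.cos (groverAngle x i))
  else 0

theorem blockCount_le (x : Fin a × Fin b → Bool) (i : Fin a) : blockCount x i ≤ b := by
  simpa [blockCount] using Finset.card_filter_le (Finset.univ : Finset (Fin b)) _

theorem sum_block (i : Fin a) (F : Fin a × Fin b → ℝ) :
    ∑ p, (if p.1 = i then F p else 0) = ∑ j, F (i, j) := by
  rw [Fintype.sum_prod_type, Finset.sum_eq_single i]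
  · simp
  · intro k _ hk; simp [hk]
  · simp

theorem sum_ite_block (x : Fin a × Fin b → Bool) (i : Fin a) (α β : ℝ) :
    ∑ j, (if x (i, j) then α else β) = blockCount x i * α + (b - blockCount x i) * β := by
  rw [Finset.sum_ite, Finset.sum_const, Finset.sum_const, nsmul_eq_mul, nsmul_eq_mul]
  have := Finset.card_filter_add_card_filter_not (s := (Finset.univ : Finset (Fin b)))
    fun j => x (i, j) = true
  rw [Finset.card_univ, Fintype.card_fin] at this
  have h : ((Finset.univ.filter fun j => ¬ x (i, j) = true).card : ℝ) = b - blockCount x i := by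
    rw [blockCount, eq_sub_iff_add_eq, add_comm]
    exact_mod_cast this
  rw [h, blockCount]

theorem blockVec_dotProduct (i : Fin a) (v : Fin a × Fin b → ℝ) :
    blockVec i ⬝ᵥ v = 1 / √b * ∑ j, v (i, j) := by
  simp only [dotProduct, blockVec, ite_mul, zero_mul]
  rw [sum_block i fun p => 1 / √b * v p, Finset.mul_sum]

theorem blockVec_dotProduct_self (hb : 0 < b) (i : Fin a) :
    (blockVec i : Fin a × Fin b → ℝ) ⬝ᵥ blockVec i = 1 := by
  have h : √(b : ℝ) * √b = b := Real.mul_self_sqrt (Nat.cast_nonneg b)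
  have h0 : √(b : ℝ) ≠ 0 := by positivity
  rw [blockVec_dotProduct]
  simp only [blockVec, if_true, Finset.sum_const, Finset.card_univ, Fintype.card_fin, nsmul_eq_mul]
  field_simp
  rw [sq, h]

theorem sin_groverAngle (x : Fin a × Fin b → Bool) (i : Fin a) :
    Real.sin (groverAngle x i) = √(blockCount x i / b) := by
  refine Real.sin_arcsin (by linarith [Real.sqrt_nonneg (blockCount x i / b : ℝ)]) ?_
  rw [Real.sqrt_le_one]
  exact div_le_one_of_le₀ (by exact_mod_cast blockCount_le x i) (Nat.cast_nonneg _)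

theorem mul_sin_groverAngle_sq (hb : 0 < b) (x : Fin a × Fin b → Bool) (i : Fin a) :
    b * Real.sin (groverAngle x i) ^ 2 = blockCount x i := by
  rw [sin_groverAngle, Real.sq_sqrt (by positivity)]
  field_simp

theorem mul_cos_groverAngle_sq (hb : 0 < b) (x : Fin a × Fin b → Bool) (i : Fin a) :
    b * Real.cos (groverAngle x i) ^ 2 = b - blockCount x i := by
  rw [Real.cos_sq', mul_sub, mul_sin_groverAngle_sq hb, mul_one]

/-- Together with the cosine version, this shows that the denominators in `groverVec` vanish only in
branches that no position of the block enters. -/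
theorem sin_groverAngle_ne_zero (hb : 0 < b) {x : Fin a × Fin b → Bool} {p : Fin a × Fin b}
    (hp : x p = true) : Real.sin (groverAngle x p.1) ≠ 0 := by
  intro h
  have := mul_sin_groverAngle_sq hb x p.1
  rw [h] at this
  have h2 : 0 < blockCount x p.1 := Finset.card_pos.2 ⟨p.2, by simp [hp]⟩
  have h3 : (0 : ℝ) < blockCount x p.1 := by exact_mod_cast h2
  rw [← this] at h3
  norm_num at h3

theorem cos_groverAngle_ne_zero (hb : 0 < b) {x : Fin a × Fin b → Bool} {p : Fin a × Fin b}
    (hp : ¬ x p = true) : Real.cos (groverAngle x p.1) ≠ 0 := by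
  intro h
  have := mul_cos_groverAngle_sq hb x p.1
  rw [h] at this
  have h2 : blockCount x p.1 < b := by
    have : blockCount x p.1 < (Finset.univ : Finset (Fin b)).card :=
      Finset.card_lt_card ((Finset.filter_ssubset).2 ⟨p.2, Finset.mem_univ _, hp⟩)
    simpa using this
  have h3 : (blockCount x p.1 : ℝ) < b := by exact_mod_cast h2
  norm_num at this
  linarith

theorem groverVec_zero (hb : 0 < b) (x : Fin a × Fin b → Bool) (i : Fin a) :
    groverVec x i 0 = blockVec i := by
  have h0 : √(b : ℝ) ≠ 0 := by positivity
  funext p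
  by_cases hp : p.1 = i
  · subst hp
    simp only [groverVec, blockVec, if_true, Nat.cast_zero, mul_zero, zero_add, one_mul]
    split_ifs with h
    · have := sin_groverAngle_ne_zero hb h
      field_simp
    · have := cos_groverAngle_ne_zero hb h
      field_simp
  · simp [groverVec, blockVec, hp]

/-- One iteration rotates by twice the angle. The sign sits on the zeros and the reflection is `1 -
2ss*`; both are the negatives of the usual choices, so the product is the usual one. -/
theorem groverVec_succ (hb : 0 < b) (x : Fin a × Fin b → Bool) (i : Fin a) (r : ℕ)
    (v : Fin a × Fin b → ℝ) (hv : v = fun p => if x p then groverVec x i r p else -groverVec x i r p)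
    (p : Fin a × Fin b) :
    v p - 2 * (blockVec i ⬝ᵥ v) / (blockVec i ⬝ᵥ (blockVec i : Fin a × Fin b → ℝ)) * blockVec i p =
      groverVec x i (r + 1) p := by
  have h0 : √(b : ℝ) ≠ 0 := by positivity
  have hbb : √(b : ℝ) * √b = b := Real.mul_self_sqrt (Nat.cast_nonneg b)
  set θ := groverAngle x i with hθ
  have hdot : blockVec i ⬝ᵥ v = -Real.cos ((2 * r + 2) * θ) := by
    rw [blockVec_dotProduct]
    have : ∀ j, v (i, j) = if x (i, j) then
        Real.sin ((2 * r + 1) * θ) / (√b * Real.sin θ) else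
        -(Real.cos ((2 * r + 1) * θ) / (√b * Real.cos θ)) := by
      intro j
      rw [hv]
      simp only [groverVec, if_true]
      split_ifs <;> rfl
    simp only [this]
    rw [sum_ite_block, ← mul_cos_groverAngle_sq hb, ← mul_sin_groverAngle_sq hb, ← hθ]
    have e1 : ∀ s c : ℝ, 1 / √(b : ℝ) * (b * s ^ 2 * (c / (√b * s))) = s * c := by
      intro s c
      by_cases hs : s = 0
      · simp [hs]
      · field_simp
        rw [sq, hbb]
    have e2 : (2 * r + 2) * θ = (2 * r + 1) * θ + θ := by ring
    rw [mul_add, mul_neg, mul_neg, e1, e1, e2, Real.cos_add]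
    ring
  rw [hdot, blockVec_dotProduct_self hb, div_one, hv]
  by_cases hp : p.1 = i
  · subst hp
    simp only [groverVec, blockVec, if_true, ← hθ]
    push_cast
    split_ifs with h
    · have := sin_groverAngle_ne_zero hb h
      rw [← hθ] at this
      field_simp
      have e : Real.sin (θ * (2 * (r + 1) + 1)) - Real.sin (θ * (2 * r + 1)) =
          2 * Real.cos (θ * (2 * r + 2)) * Real.sin θ := by
        rw [Real.sin_sub_sin]
        ring_nf
      ring_nf at e ⊢
      linarith
    · have := cos_groverAngle_ne_zero hb h
      rw [← hθ] at this
      field_simp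
      have e : Real.cos (θ * (2 * (r + 1) + 1)) + Real.cos (θ * (2 * r + 1)) =
          2 * Real.cos (θ * (2 * r + 2)) * Real.cos θ := by
        rw [Real.cos_add_cos]
        ring_nf
      ring_nf at e ⊢
      linarith
  · simp [groverVec, blockVec, hp]

theorem Reach.grover {W : Type} [Fintype W] [DecidableEq W] (hb : 0 < b)
    {s₀ : (Fin a × Fin b) × Bool × W} {T : ℕ} {α : (Fin a × Fin b → Bool) → W → ℂ}
    {p₀ : Fin a × Fin b} (h : Reach s₀ T fun x => productState (α x) fun _ => Pi.single p₀ 1)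
    (i : W → Fin a) (r : ℕ) :
    Reach s₀ (T + 2 * r) fun x => productState (α x) fun z => groverVec x (i z) r := by
  induction r with
  | zero =>
    refine (h.prepare (s := fun z => blockVec (i z)) (fun _ => by simp)
      fun z => blockVec_dotProduct_self hb (i z)).of_eq rfl fun x s => ?_
    simp only [productState, groverVec_zero hb]
  | succ r ih =>
    refine (ih.phase.reflection fun z => blockVec (i z)).of_eq (by ring) fun x s => ?_
    simp only [productState]
    rw [groverVec_succ hb x (i s.2.2) r _ rfl]

/-- The sampled index is a one with probability `sin²` of the rotated angle; `A` and `B` are the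
payoffs of success and failure. An inequality suffices for the degenerate case of a block full of
ones. -/
theorem sum_groverVec_sq_ones (hb : 0 < b) {x : Fin a × Fin b → Bool} {p : Fin a × Fin b}
    (hp : x p = true) (r : ℕ) (A B : ℝ) (hB : 0 ≤ B) :
    ∑ q, groverVec x p.1 r q ^ 2 * (if x q then A else B) ≤
      Real.sin ((2 * r + 1) * groverAngle x p.1) ^ 2 * A +
      (1 - Real.sin ((2 * r + 1) * groverAngle x p.1) ^ 2) * B := by
  have h0 : √(b : ℝ) ≠ 0 := by positivity
  have hbb : √(b : ℝ) ^ 2 = b := Real.sq_sqrt (Nat.cast_nonneg b)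
  have hs := sin_groverAngle_ne_zero hb hp
  set i := p.1
  set θ := groverAngle x i with hθ
  set S := Real.sin ((2 * r + 1) * θ) with hS
  set C := Real.cos ((2 * r + 1) * θ) with hC
  have e : ∀ q, groverVec x i r q ^ 2 * (if x q then A else B) = if q.1 = i then
      (if x q then (S / (√b * Real.sin θ)) ^ 2 * A else (C / (√b * Real.cos θ)) ^ 2 * B) else 0 := by
    intro q
    simp only [groverVec]
    split_ifs <;> simp [hS, hC, hθ]
  simp only [e]
  rw [sum_block i fun q => if x q then (S / (√b * Real.sin θ)) ^ 2 * A else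
    (C / (√b * Real.cos θ)) ^ 2 * B, sum_ite_block, ← mul_cos_groverAngle_sq hb,
    ← mul_sin_groverAngle_sq hb, ← hθ, hS, ← Real.cos_sq', ← hC, ← hS]
  refine add_le_add (le_of_eq ?_) ?_
  · rw [div_pow, mul_pow, hbb]
    field_simp
  · by_cases hc : Real.cos θ = 0
    · rw [hc]
      simp only [ne_eq, OfNat.ofNat_ne_zero, not_false_eq_true, zero_pow, mul_zero, zero_mul]
      positivity
    · rw [div_pow, mul_pow, hbb]
      refine le_of_eq ?_
      field_simp

theorem two_mul_pred_div_two_add_one (k : ℕ) : 2 * ((3 ^ k - 1) / 2) + 1 = 3 ^ k := by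
  have h : 3 ^ k % 2 = 1 := by rw [Nat.pow_mod]; simp
  generalize 3 ^ k = n at h ⊢
  omega

/-- For one of the iteration numbers `(3 ^ k - 1) / 2` the search succeeds with probability at
least `1/16`. -/
theorem exists_one_sixteenth_le_sin_sq {m M : ℕ} (hm : 0 < m) (hM : m ≤ 3 ^ M)
    {x : Fin a × Fin (m ^ 2) → Bool} {p : Fin a × Fin (m ^ 2)} (hp : x p = true) :
    ∃ k ≤ M, 1 / 16 ≤
      Real.sin ((2 * ((3 ^ k - 1) / 2 : ℕ) + 1) * groverAngle x p.1) ^ 2 := by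
  set θ := groverAngle x p.1 with hθ
  have hsin : 1 / (m : ℝ) ≤ Real.sin θ := by
    rw [hθ, sin_groverAngle]
    refine Real.le_sqrt_of_sq_le ?_
    have h2 : 0 < blockCount x p.1 := Finset.card_pos.2 ⟨p.2, by simp [hp]⟩
    have h3 : (1 : ℝ) ≤ blockCount x p.1 := by exact_mod_cast h2
    rw [div_pow, one_pow]
    push_cast
    gcongr
  have hθ0 : 0 ≤ θ := Real.arcsin_nonneg.2 (Real.sqrt_nonneg _)
  have hθ1 : θ ≤ Real.pi / 2 := Real.arcsin_le_pi_div_two _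
  have hθm : 1 / (m : ℝ) ≤ θ := hsin.trans (Real.sin_le hθ0)
  -- Take the least such `k`: tripling cannot jump over the interval from `1/2` to `π/2`, since a
  -- predecessor below `1/2` gives a value below `3/2`. There the sine is at least `2y/π ≥ 1/4`.
  have hex : ∃ k : ℕ, 1 / 2 ≤ 3 ^ k * θ := by
    refine ⟨M, ?_⟩
    have hm' : (m : ℝ) ≤ 3 ^ M := by exact_mod_cast hM
    have hm0 : (0 : ℝ) < m := by exact_mod_cast hm
    have : 1 ≤ (m : ℝ) * θ := by rwa [div_le_iff₀' hm0] at hθm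
    nlinarith
  classical
  have hle : Nat.find hex ≤ M := by
    refine Nat.find_min' hex ?_
    have hm' : (m : ℝ) ≤ 3 ^ M := by exact_mod_cast hM
    have hm0 : (0 : ℝ) < m := by exact_mod_cast hm
    have : 1 ≤ (m : ℝ) * θ := by rwa [div_le_iff₀' hm0] at hθm
    nlinarith
  refine ⟨Nat.find hex, hle, ?_⟩
  have hlow := Nat.find_spec hex
  have hhigh : 3 ^ Nat.find hex * θ ≤ Real.pi / 2 := by
    rcases Nat.eq_zero_or_pos (Nat.find hex) with h | h
    · rw [h]; simpa using hθ1
    · have := Nat.find_min hex (Nat.sub_lt h one_pos)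
      obtain ⟨k, hk⟩ := Nat.exists_eq_succ_of_ne_zero h.ne'
      rw [hk] at this ⊢
      simp only [Nat.succ_sub_one, not_le, pow_succ] at this ⊢
      linarith [Real.pi_gt_three]
  have hr : ((2 * ((3 ^ Nat.find hex - 1) / 2 : ℕ) + 1 : ℝ)) = 3 ^ Nat.find hex := by
    exact_mod_cast two_mul_pred_div_two_add_one (Nat.find hex)
  rw [hr]
  set y := 3 ^ Nat.find hex * θ
  have h1 := Real.mul_le_sin (by linarith) hhigh
  have h2 : 1 / 4 ≤ 2 / Real.pi * y := by
    rw [div_mul_eq_mul_div, le_div_iff₀ Real.pi_pos]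
    linarith [Real.pi_le_four]
  nlinarith

end Grover

/-! ### The search over all blocks and its supermartingale. -/

section Search

variable {m b : ℕ}

/-- The blocks in which the records `u` show a one. -/
def hitBlocks {n : ℕ} (u : Fin n → (Fin m × Fin b) × Bool) : Finset (Fin m) :=
  Finset.univ.filter fun i => ∃ q, (u q).2 = true ∧ (u q).1.1 = i

/-- A block outside `F`, if there is one. -/
noncomputable def targetBlock [Nonempty (Fin m)] (F : Finset (Fin m)) : Fin m :=
  Classical.epsilon fun i => i ∉ F

theorem targetBlock_notMem [Nonempty (Fin m)] {F : Finset (Fin m)} (hF : F ≠ Finset.univ) :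
    targetBlock F ∉ F := by
  refine Classical.epsilon_spec (p := fun i => i ∉ F) ?_
  by_contra! h
  exact hF (Finset.eq_univ_of_forall h)

/-- Fresh slots carry the bit `false`, so they show no hit, and overwriting one loses none. -/
theorem hitBlocks_update {n : ℕ} (u : Fin n → (Fin m × Fin b) × Bool) (q : Fin n)
    (hq : (u q).2 = false) (p : Fin m × Fin b) (v : Bool) :
    hitBlocks (Function.update u q (p, v)) = if v then insert p.1 (hitBlocks u) else hitBlocks u := by
  have h1 : ∀ i, i ∈ hitBlocks (Function.update u q (p, v)) ↔
      (v = true ∧ p.1 = i) ∨ i ∈ hitBlocks u := by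
    intro i
    simp only [hitBlocks, Finset.mem_filter, Finset.mem_univ, true_and]
    constructor
    · rintro ⟨q', h⟩
      by_cases hqq : q' = q
      · subst hqq
        rw [Function.update_self] at h
        exact Or.inl h
      · rw [Function.update_of_ne hqq] at h
        exact Or.inr ⟨q', h⟩
    · rintro (h | ⟨q', h⟩)
      · exact ⟨q, by rwa [Function.update_self]⟩
      · refine ⟨q', ?_⟩
        rwa [Function.update_of_ne]
        rintro rfl
        rw [hq] at h
        exact Bool.noConfusion h.1
  ext i
  rw [h1]
  cases v <;> simp [eq_comm]

/-- There are blocks outside `F`, and the one to be searched next has a one. -/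
def SearchOpen [Nonempty (Fin m)] (x : Fin m × Fin b → Bool) (F : Finset (Fin m)) : Prop :=
  F ≠ Finset.univ ∧ ∃ j, x (targetBlock F, j) = true

/-- The number of `q' < q` that are `k` modulo `P`. -/
def passCount (P q k : ℕ) : ℕ :=
  q / P + if k < q % P then 1 else 0

theorem succ_div_mod (P q : ℕ) (hP : 0 < P) :
    ((q + 1) / P = q / P ∧ (q + 1) % P = q % P + 1) ∨
      ((q + 1) / P = q / P + 1 ∧ (q + 1) % P = 0 ∧ q % P + 1 = P) := by
  have h := Nat.mod_add_div q P
  have hlt := Nat.mod_lt q hP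
  rcases Nat.lt_or_ge (q % P + 1) P with h1 | h1
  · left
    exact (Nat.div_mod_unique hP).2 ⟨by omega, h1⟩
  · right
    have : (q + 1) / P = q / P + 1 ∧ (q + 1) % P = 0 :=
      (Nat.div_mod_unique hP).2 ⟨by rw [mul_add]; omega, hP⟩
    exact ⟨this.1, this.2, by omega⟩

/-- Two different residues are allowed because a hit changes the target block and with it the good
level; cyclic counts of different residues stay within one of each other. -/
theorem passCount_succ_le (P q k k' : ℕ) (hP : 0 < P) :
    passCount P (q + 1) k' ≤ passCount P q k + 1 := by
  rcases succ_div_mod P q hP with ⟨h1, h2⟩ | ⟨h1, h2, -⟩ <;> simp only [passCount, h1, h2] <;>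
    split_ifs <;> omega

theorem passCount_succ_le_of_ne {P q k : ℕ} (hP : 0 < P) (hk : k < P) (hne : q % P ≠ k) :
    passCount P (q + 1) k ≤ passCount P q k := by
  rcases succ_div_mod P q hP with ⟨h1, h2⟩ | ⟨h1, h2, h3⟩ <;> simp only [passCount, h1, h2] <;>
    split_ifs <;> omega

open Classical in
/-- A supermartingale of the search: it bounds the probability that the search is still open. -/
noncomputable def potential [Nonempty (Fin m)] (κ : (Fin m × Fin b → Bool) → Fin m → ℕ) (P : ℕ)
    (x : Fin m × Fin b → Bool) (q : ℕ) (F : Finset (Fin m)) : ℝ :=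
  if SearchOpen x F then
    (1 / 2) ^ F.card * (32 / 31) ^ passCount P q (κ x (targetBlock F)) else 0

theorem sum_potential_le [Nonempty (Fin m)] (hb : 0 < b)
    {κ : (Fin m × Fin b → Bool) → Fin m → ℕ} {M : ℕ}
    (hκ : ∀ x (p : Fin m × Fin b), x p = true → κ x p.1 ≤ M ∧ 1 / 16 ≤
      Real.sin ((2 * ((3 ^ κ x p.1 - 1) / 2 : ℕ) + 1) * groverAngle x p.1) ^ 2)
    (x : Fin m × Fin b → Bool) (q : ℕ) (F : Finset (Fin m)) :
    ∑ p, groverVec x (targetBlock F) ((3 ^ (q % (M + 1)) - 1) / 2) p ^ 2 *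
      potential κ (M + 1) x (q + 1) (if x p then insert p.1 F else F) ≤
    potential κ (M + 1) x q F := by
  classical
  set r := (3 ^ (q % (M + 1)) - 1) / 2 with hr
  set i := targetBlock F with hi
  have hg : ∀ p : Fin m × Fin b, p.1 ≠ i → groverVec x i r p = 0 := fun p hp => by
    rw [groverVec, if_neg hp]
  by_cases hopen : SearchOpen x F
  · obtain ⟨hF, j, hj⟩ := id hopen
    have hiF : i ∉ F := targetBlock_notMem hF
    obtain ⟨hκM, hgood⟩ := hκ x (i, j) hj
    set c := passCount (M + 1) q (κ x i) with hc
    set A : ℝ := (1 / 2) ^ F.card * (32 / 31) ^ c with hA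
    have hA0 : 0 ≤ A := by positivity
    have hpot : potential κ (M + 1) x q F = A := by rw [potential, if_pos hopen]
    -- A hit multiplies the potential by at most `(1/2) * (32/31) = 16/31`; a failure costs the
    -- factor `32/31` only at the good level.
    set B : ℝ := if q % (M + 1) = κ x i then 32 / 31 else 1 with hB
    have hB0 : 0 ≤ B := by rw [hB]; split_ifs <;> norm_num
    have hterm : ∀ p, groverVec x i r p ^ 2 *
        potential κ (M + 1) x (q + 1) (if x p then insert p.1 F else F) ≤
        groverVec x i r p ^ 2 * (if x p then A * (16 / 31) else A * B) := by
      intro p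
      by_cases hp : p.1 = i
      swap
      · rw [hg p hp]; simp
      refine mul_le_mul_of_nonneg_left ?_ (sq_nonneg _)
      rw [hp]
      split_ifs with hxp
      · rw [potential]
        split_ifs
        swap
        · positivity
        rw [Finset.card_insert_of_notMem hiF, pow_succ]
        have h1 : (32 / 31 : ℝ) ^ passCount (M + 1) (q + 1) (κ x (targetBlock (insert i F))) ≤
            (32 / 31) ^ (c + 1) :=
          pow_le_pow_right₀ (by norm_num) (passCount_succ_le _ _ _ _ M.succ_pos)
        calc _ ≤ (1 / 2 : ℝ) ^ F.card * (1 / 2) * (32 / 31) ^ (c + 1) :=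
              mul_le_mul_of_nonneg_left h1 (by positivity)
          _ = _ := by rw [hA, pow_succ]; ring
      · rw [potential, if_pos hopen, ← hi, hA, mul_assoc]
        refine mul_le_mul_of_nonneg_left ?_ (by positivity)
        rw [hB]
        split_ifs with hq
        · rw [← pow_succ]
          exact pow_le_pow_right₀ (by norm_num) (passCount_succ_le _ _ _ _ M.succ_pos)
        · rw [mul_one]
          exact pow_le_pow_right₀ (by norm_num)
            (passCount_succ_le_of_ne M.succ_pos (Nat.lt_succ_of_le hκM) hq)
    refine (Finset.sum_le_sum fun p _ => hterm p).trans ?_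
    refine (sum_groverVec_sq_ones hb hj r _ _ (mul_nonneg hA0 hB0)).trans ?_
    rw [hpot]
    set s : ℝ := Real.sin ((2 * r + 1) * groverAngle x i) ^ 2 with hs
    have hs0 : 0 ≤ s := sq_nonneg _
    -- At the good level the mean factor is `(32 - 16 * s) / 31 ≤ 1`, by `s ≥ 1/16`, which is where
    -- `32/31` comes from; at other levels it is `1 - 15 * s / 31`.
    rw [hB]
    split_ifs with hq
    · have : 1 / 16 ≤ s := by rw [hs, hr, hq]; exact hgood
      nlinarith
    · nlinarith
  · rw [potential, if_neg hopen]
    -- A closed search stays closed: either all blocks are already hit, or the target has no one to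
    -- be sampled.
    refine le_of_eq (Finset.sum_eq_zero fun p _ => ?_)
    by_cases hp : p.1 = i
    swap
    · rw [hg p hp]; simp
    rw [potential, if_neg, mul_zero]
    rintro ⟨h1, h2⟩
    split_ifs at h1 h2 with hxp
    · refine hopen ⟨fun e => h1 ?_, p.2, ?_⟩
      · rw [e]; simp
      · rw [← hi, ← hp]; exact hxp
    · exact hopen ⟨h1, h2⟩

/-- The state of the search after the first `q` attempts. -/
theorem exists_reach_attempts [Nonempty (Fin m)] (hb : 0 < b)
    {κ : (Fin m × Fin b → Bool) → Fin m → ℕ} {M : ℕ}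
    (hκ : ∀ x (p : Fin m × Fin b), x p = true → κ x p.1 ≤ M ∧ 1 / 16 ≤
      Real.sin ((2 * ((3 ^ κ x p.1 - 1) / 2 : ℕ) + 1) * groverAngle x p.1) ^ 2)
    (p₀ : Fin m × Fin b) (n : ℕ) (q : ℕ) (hq : q ≤ n) :
    ∃ α : (Fin m × Fin b → Bool) → (Fin n ⊕ Fin b → (Fin m × Fin b) × Bool) → ℂ,
      Reach (p₀, false, fun _ => (p₀, false)) (∑ q' ∈ Finset.range q, 3 ^ (q' % (M + 1)))
        (fun x => productState (α x) fun _ => Pi.single p₀ 1) ∧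
      (∀ x h, α x h ≠ 0 →
        (∀ t : Fin n, t < q → (h (Sum.inl t)).2 = x (h (Sum.inl t)).1) ∧
        (∀ t : Fin n, q ≤ t → h (Sum.inl t) = (p₀, false)) ∧
        ∀ j, h (Sum.inr j) = (p₀, false)) ∧
      ∀ x, ∑ h, ‖α x h‖ ^ 2 * potential κ (M + 1) x q (hitBlocks (h ∘ Sum.inl)) ≤ 1 := by
  classical
  induction q with
  | zero =>
    refine ⟨fun _ => Pi.single (fun _ => (p₀, false)) 1, Reach.init.of_eq (by simp) ?_, ?_, ?_⟩
    · rintro x ⟨j, v, h⟩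
      simp only [productState, Pi.single_apply, Prod.mk.injEq]
      cases v <;> by_cases h1 : j = p₀ <;> by_cases h2 : h = fun _ => (p₀, false) <;>
        simp [h1, h2]
    · intro x h hne
      have : h = fun _ => (p₀, false) := by
        by_contra hh
        simp [hh] at hne
      subst this
      simp
    · intro x
      rw [Finset.sum_eq_single fun _ => (p₀, false)]
      · beta_reduce
        rw [Pi.single_eq_same, norm_one, one_pow, one_mul, potential]
        split_ifs
        · simp only [passCount, Nat.zero_div, Nat.zero_mod, not_lt_zero, if_false, add_zero,
            pow_zero, mul_one]
          exact pow_le_one₀ (by norm_num) (by norm_num)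
        · exact zero_le_one
      · intro h _ hh; simp [hh]
      · simp
  | succ q ih =>
    obtain ⟨α, hr, hsupp, hpot⟩ := ih (Nat.le_of_succ_le hq)
    have hrG := hr.grover hb (fun h => targetBlock (hitBlocks (h ∘ Sum.inl)))
      ((3 ^ (q % (M + 1)) - 1) / 2)
    obtain ⟨α', hr', hsupp', hsum'⟩ := hrG.record (Sum.inl ⟨q, hq⟩)
      fun x h hne => (hsupp x h hne).2.1 ⟨q, hq⟩ le_rfl
    refine ⟨α', hr'.of_eq ?_ fun _ _ => rfl, ?_, fun x => ?_⟩
    -- With `r = (3 ^ k - 1) / 2` the `2 * r` queries of the search and the one of the record make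
    -- `3 ^ k`.
    · rw [Finset.sum_range_succ, add_assoc, two_mul_pred_div_two_add_one]
    · intro x h' hne
      obtain ⟨h, p, hα, -, rfl⟩ := hsupp' x h' hne
      obtain ⟨s1, s2, s3⟩ := hsupp x h hα
      refine ⟨fun t ht => ?_, fun t ht => ?_, fun j => ?_⟩
      · by_cases htq : t = ⟨q, hq⟩
        · subst htq; simp
        · have hlt : (t : ℕ) < q := by
            have : (t : ℕ) ≠ q := fun e => htq (Fin.ext e)
            omega
          have : (Sum.inl t : Fin n ⊕ Fin b) ≠ Sum.inl ⟨q, hq⟩ := fun e => htq (Sum.inl.inj e)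
          rw [Function.update_of_ne this]
          exact s1 t hlt
      · have : (Sum.inl t : Fin n ⊕ Fin b) ≠ Sum.inl ⟨q, hq⟩ := fun e => by
          have := congrArg Fin.val (Sum.inl.inj e)
          simp only at this
          omega
        rw [Function.update_of_ne this]
        exact s2 t (by omega)
      · rw [Function.update_of_ne (by simp)]
        exact s3 j
    · rw [hsum' x fun h => potential κ (M + 1) x (q + 1) (hitBlocks (h ∘ Sum.inl))]
      refine (Finset.sum_le_sum fun h _ => ?_).trans (hpot x)
      by_cases hα : α x h = 0
      · simp [hα]
      refine mul_le_mul_of_nonneg_left ?_ (sq_nonneg _)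
      have hslot : ((h ∘ Sum.inl) ⟨q, hq⟩).2 = false := by
        rw [Function.comp_apply, (hsupp x h hα).2.1 ⟨q, hq⟩ le_rfl]
      simp only [Sum.update_inl_comp_inl, hitBlocks_update _ _ hslot]
      exact sum_potential_le hb hκ x q _

/-- The state after the attempts and after the queries to the positions `J` of the block that is
still to be searched. -/
theorem exists_reach_verified [Nonempty (Fin m)] (hb : 0 < b)
    {κ : (Fin m × Fin b → Bool) → Fin m → ℕ} {M : ℕ}
    (hκ : ∀ x (p : Fin m × Fin b), x p = true → κ x p.1 ≤ M ∧ 1 / 16 ≤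
      Real.sin ((2 * ((3 ^ κ x p.1 - 1) / 2 : ℕ) + 1) * groverAngle x p.1) ^ 2)
    (p₀ : Fin m × Fin b) (n : ℕ) (J : Finset (Fin b)) :
    ∃ α : (Fin m × Fin b → Bool) → (Fin n ⊕ Fin b → (Fin m × Fin b) × Bool) → ℂ,
      Reach (p₀, false, fun _ => (p₀, false))
        (∑ q' ∈ Finset.range n, 3 ^ (q' % (M + 1)) + J.card)
        (fun x => productState (α x) fun _ => Pi.single p₀ 1) ∧
      (∀ x h, α x h ≠ 0 →
        (∀ t : Fin n, (h (Sum.inl t)).2 = x (h (Sum.inl t)).1) ∧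
        (∀ j ∈ J, (h (Sum.inr j)).2 = x (targetBlock (hitBlocks (h ∘ Sum.inl)), j)) ∧
        ∀ j ∉ J, h (Sum.inr j) = (p₀, false)) ∧
      ∀ x, ∑ h, ‖α x h‖ ^ 2 * potential κ (M + 1) x n (hitBlocks (h ∘ Sum.inl)) ≤ 1 := by
  classical
  induction J using Finset.induction_on with
  | empty =>
    obtain ⟨α, hr, hsupp, hpot⟩ := exists_reach_attempts hb hκ p₀ n n le_rfl
    exact ⟨α, hr, fun x h hne => ⟨fun t => (hsupp x h hne).1 t t.2, by simp,
      fun j _ => (hsupp x h hne).2.2 j⟩, hpot⟩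
  | insert k J hk ih =>
    obtain ⟨α, hr, hsupp, hpot⟩ := ih
    -- The target is read off the attempt slots only, so it does not move while the verification
    -- slots are filled.
    have hrP := hr.prepare (s := fun h => Pi.single (targetBlock (hitBlocks (h ∘ Sum.inl)), k) 1)
      (fun _ => by simp) fun _ => by simp
    obtain ⟨α', hr', hsupp', hsum'⟩ := hrP.record (Sum.inr k)
      fun x h hne => (hsupp x h hne).2.2 k hk
    refine ⟨α', hr'.of_eq ?_ fun _ _ => rfl, ?_, fun x => ?_⟩
    · rw [Finset.card_insert_of_notMem hk, add_assoc]
    · intro x h' hne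
      obtain ⟨h, p, hα, hp, rfl⟩ := hsupp' x h' hne
      have hp' : p = (targetBlock (hitBlocks (h ∘ Sum.inl)), k) := by
        by_contra hh
        simp [hh] at hp
      obtain ⟨s1, s2, s3⟩ := hsupp x h hα
      refine ⟨fun t => ?_, fun j hj => ?_, fun j hj => ?_⟩
      · rw [Function.update_of_ne (by simp)]
        exact s1 t
      · rw [Sum.update_inr_comp_inl]
        by_cases hjk : j = k
        · subst hjk
          rw [Function.update_self, hp']
        · rw [Function.update_of_ne fun e => hjk (Sum.inr.inj e)]
          exact s2 j ((Finset.mem_insert.1 hj).resolve_left hjk)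
      · rw [Finset.mem_insert, not_or] at hj
        rw [Function.update_of_ne fun e => hj.1 (Sum.inr.inj e)]
        exact s3 j hj.2
    · rw [hsum' x fun h => potential κ (M + 1) x n (hitBlocks (h ∘ Sum.inl))]
      refine (Finset.sum_le_sum fun h _ => ?_).trans (hpot x)
      refine mul_le_mul_of_nonneg_left (le_of_eq ?_) (sq_nonneg _)
      simp only [Sum.update_inr_comp_inl]
      rw [← Finset.sum_mul, Finset.sum_eq_single (targetBlock (hitBlocks (h ∘ Sum.inl)), k)]
      · simp
      · intro p _ hp; simp [hp]
      · simp

end Search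

/-! ### Query count, output rules and the upper bounds. -/

theorem sum_three_pow_mod_le (M L : ℕ) :
    2 * ∑ q ∈ Finset.range ((M + 1) * L), 3 ^ (q % (M + 1)) ≤ L * 3 ^ (M + 1) := by
  have hgeom : ∀ k : ℕ, 2 * ∑ q ∈ Finset.range k, 3 ^ q ≤ 3 ^ k := by
    intro k
    induction k with
    | zero => simp
    | succ k ih => rw [Finset.sum_range_succ, pow_succ]; omega
  induction L with
  | zero => simp
  | succ L ih =>
    have h : ∑ q ∈ Finset.range (M + 1), 3 ^ (((M + 1) * L + q) % (M + 1)) =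
        ∑ q ∈ Finset.range (M + 1), 3 ^ q := by
      refine Finset.sum_congr rfl fun q hq => ?_
      rw [Nat.mul_add_mod, Nat.mod_eq_of_lt (Finset.mem_range.1 hq)]
    rw [Nat.mul_succ, Finset.sum_range_add, h, add_mul L, mul_add 2, one_mul]
    exact add_le_add ih (hgeom _)

open Classical in
/-- A search for a one in each block, with `O(m ^ 2)` queries. The records of the final state are
true, and with probability at least `1/2` they show a one in each block or the next block has
no ones; the positions of that block have been queried. -/
theorem exists_search {m : ℕ} [Nonempty (Fin m)] (hm : 0 < m) :
    ∃ (n T : ℕ) (p₀ : Fin m × Fin (m ^ 2))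
      (α : (Fin m × Fin (m ^ 2) → Bool) →
        (Fin n ⊕ Fin (m ^ 2) → (Fin m × Fin (m ^ 2)) × Bool) → ℂ),
      T ≤ 199 * m ^ 2 ∧
      Reach (p₀, false, fun _ => (p₀, false)) T
        (fun x => productState (α x) fun _ => Pi.single p₀ 1) ∧
      (∀ x h, α x h ≠ 0 →
        (∀ t : Fin n, (h (Sum.inl t)).2 = x (h (Sum.inl t)).1) ∧
        ∀ j, (h (Sum.inr j)).2 = x (targetBlock (hitBlocks (h ∘ Sum.inl)), j)) ∧
      ∀ x, ∑ h, ‖α x h‖ ^ 2 *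
        (if SearchOpen x (hitBlocks (h ∘ Sum.inl)) then 1 else 0) ≤ 1 / 2 := by
  have hb : 0 < m ^ 2 := by positivity
  obtain ⟨M, hM, hM3⟩ : ∃ M, m ≤ 3 ^ M ∧ 3 ^ M ≤ 3 * m := by
    refine ⟨Nat.clog 3 m, Nat.le_pow_clog (by norm_num) m, ?_⟩
    rcases Nat.lt_or_ge 1 m with h | h
    · have h1 := Nat.pow_pred_clog_lt_self (b := 3) (by norm_num) h
      have h2 : Nat.clog 3 m ≠ 0 := (Nat.clog_pos (by norm_num) h).ne'
      obtain ⟨k, hk⟩ := Nat.exists_eq_succ_of_ne_zero h2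
      rw [hk, Nat.pred_succ] at h1
      rw [hk, pow_succ]
      omega
    · rw [Nat.clog_of_right_le_one h]
      omega
  have hex : ∀ (x : Fin m × Fin (m ^ 2) → Bool) (i : Fin m), ∃ k, ∀ j, x (i, j) = true → k ≤ M ∧
      1 / 16 ≤ Real.sin ((2 * ((3 ^ k - 1) / 2 : ℕ) + 1) * groverAngle x i) ^ 2 := by
    intro x i
    by_cases h : ∃ j, x (i, j) = true
    · obtain ⟨j, hj⟩ := h
      obtain ⟨k, hk, hs⟩ := exists_one_sixteenth_le_sin_sq hm hM hj
      exact ⟨k, fun _ _ => ⟨hk, hs⟩⟩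
    · exact ⟨0, fun j hj => absurd ⟨j, hj⟩ h⟩
  choose κ hκ using hex
  set p₀ : Fin m × Fin (m ^ 2) := (⟨0, hm⟩, ⟨0, hb⟩)
  obtain ⟨α, hr, hsupp, hpot⟩ := exists_reach_verified hb (fun x p hp => hκ x p.1 p.2 hp) p₀
    ((M + 1) * (44 * m)) Finset.univ
  refine ⟨_, _, p₀, α, ?_, hr, fun x h hne => ⟨(hsupp x h hne).1, fun j =>
    (hsupp x h hne).2.1 j (Finset.mem_univ j)⟩, fun x => ?_⟩
  · have h1 := sum_three_pow_mod_le M (44 * m)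
    have h2 : 44 * m * 3 ^ (M + 1) ≤ 44 * m * (9 * m) := by
      refine Nat.mul_le_mul_left _ ?_
      rw [pow_succ]; omega
    rw [Finset.card_univ, Fintype.card_fin]
    have h3 : 44 * m * (9 * m) = 2 * (198 * m ^ 2) := by ring
    omega
  · have hterm : ∀ F : Finset (Fin m), (if SearchOpen x F then (1 : ℝ) else 0) ≤
        potential κ (M + 1) x ((M + 1) * (44 * m)) F * (1 / 2) := by
      intro F
      rw [potential]
      split_ifs
      · have hcount : passCount (M + 1) ((M + 1) * (44 * m)) (κ x (targetBlock F)) = 44 * m := by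
          simp [passCount]
        rw [hcount]
        have hcard : F.card ≤ m := by simpa using Finset.card_le_univ F
        have h1 : (1 / 2 : ℝ) ^ m ≤ (1 / 2) ^ F.card :=
          pow_le_pow_of_le_one (by norm_num) (by norm_num) hcard
        -- The number `44` is chosen so that `(32/31) ^ 44 ≥ 4`; an open search then has potential
        -- at least `2 ^ m ≥ 2`, and Markov's inequality gives `1/2`.
        have h2 : (4 : ℝ) ^ m ≤ (32 / 31) ^ (44 * m) := by
          rw [pow_mul]
          exact pow_le_pow_left₀ (by norm_num) (by norm_num) m
        have h3 : (2 : ℝ) ≤ 2 ^ m := by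
          calc (2 : ℝ) = 2 ^ 1 := (pow_one 2).symm
            _ ≤ 2 ^ m := pow_le_pow_right₀ (by norm_num) hm
        have h4 : (1 / 2 : ℝ) ^ m * 4 ^ m = 2 ^ m := by rw [← mul_pow]; norm_num
        have h5 := mul_le_mul h1 h2 (by positivity) (by positivity)
        linarith
      · simp
    calc _ ≤ ∑ h, ‖α x h‖ ^ 2 * potential κ (M + 1) x ((M + 1) * (44 * m))
          (hitBlocks (h ∘ Sum.inl)) * (1 / 2) := Finset.sum_le_sum fun h _ => by
            rw [mul_assoc]
            exact mul_le_mul_of_nonneg_left (hterm _) (sq_nonneg _)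
      _ ≤ 1 / 2 := by
        rw [← Finset.sum_mul]
        linarith [hpot x]

theorem sum_norm_sq_of_reach {ι W : Type} [Fintype ι] [DecidableEq ι] [Fintype W] [DecidableEq W]
    {s₀ : ι × Bool × W} {T : ℕ} {α : (ι → Bool) → W → ℂ} {j₀ : ι}
    (h : Reach s₀ T fun x => productState (α x) fun _ => Pi.single j₀ 1) (x : ι → Bool) :
    ∑ z, ‖α x z‖ ^ 2 = 1 := by
  have h1 := h.sum_norm_sq x
  have h2 := sum_norm_sq_productState (α x) (fun _ => Pi.single j₀ 1) fun _ => 1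
  have hs1 : ∑ j, (Pi.single j₀ (1 : ℝ) : ι → ℝ) j ^ 2 = 1 := by
    rw [Finset.sum_eq_single j₀] <;> simp +contextual
  simp only [hs1, mul_one] at h2
  rw [← h2, h1]

open Classical in
theorem exists_algorithm_of_reach {ι W R : Type} [Fintype ι] [DecidableEq ι] [Fintype W]
    [DecidableEq W] {s₀ : ι × Bool × W} {T : ℕ} {α : (ι → Bool) → W → ℂ} {j₀ : ι}
    (h : Reach s₀ T fun x => productState (α x) fun _ => Pi.single j₀ 1) (out : W → R) :
    ∃ A : QuantumQueryAlgorithm ι R, A.queries = T ∧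
      (∀ s, ∃ z, A.output s = out z) ∧
      ∀ x E, A.prob x E = ∑ z, ‖α x z‖ ^ 2 * (if out z ∈ E then 1 else 0) := by
  obtain ⟨A, hT, hout, hA⟩ := h.exists_algorithm fun s => out s.2.2
  refine ⟨A, hT, fun s => ?_, fun x E => ?_⟩
  · obtain ⟨t, ht⟩ := hout s
    exact ⟨t.2.2, ht⟩
  have hs1 : ∑ j, (Pi.single j₀ (1 : ℝ) : ι → ℝ) j ^ 2 = 1 := by
    rw [Finset.sum_eq_single j₀] <;> simp +contextual
  have h2 := sum_norm_sq_productState (α x) (fun _ => Pi.single j₀ 1)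
    fun z => if out z ∈ E then (1 : ℝ) else 0
  simp only [hs1, mul_one] at h2
  rw [hA, ← h2]
  refine Finset.sum_congr rfl fun s _ => ?_
  simp [Set.indicator_apply]

theorem andOfOrs_eq_true_of_hitBlocks {m b n : ℕ} {x : Fin m × Fin b → Bool}
    {u : Fin n → (Fin m × Fin b) × Bool} (hu : ∀ t, (u t).2 = x (u t).1)
    (h : hitBlocks u = Finset.univ) : andOfOrs m b x = true := by
  rw [andOfOrs, decide_eq_true_iff]
  intro i
  have hi : i ∈ hitBlocks u := h ▸ Finset.mem_univ i
  obtain ⟨q, h1, rfl⟩ := (Finset.mem_filter.1 hi).2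
  exact ⟨(u q).1.2, by rw [← h1, hu]⟩

/-- All records in the support are true, so the answer 1 rests on a seen one in each block and the
answer 0 on a block read in full. The remaining outcomes are those of an open search. -/
theorem exists_zeroError {m : ℕ} (hm : 0 < m) :
    ∃ A : QuantumQueryAlgorithm (Fin m × Fin (m ^ 2)) (Option Bool),
      A.ZeroError (andOfOrs m (m ^ 2)) ∧ A.queries ≤ 199 * m ^ 2 := by
  classical
  have : Nonempty (Fin m) := ⟨⟨0, hm⟩⟩
  obtain ⟨n, T, p₀, α, hT, hr, hsupp, hopen⟩ := exists_search hm
  obtain ⟨A, hAT, -, hA⟩ := exists_algorithm_of_reach hr fun h =>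
    if hitBlocks (h ∘ Sum.inl) = Finset.univ then some true
    else if ∀ j, (h (Sum.inr j)).2 = false then some false else none
  refine ⟨A, fun x => ⟨?_, ?_⟩, hAT.trans_le hT⟩
  · rw [hA]
    refine (Finset.sum_le_sum fun h _ => ?_).trans (hopen x)
    by_cases hα : α x h = 0
    · simp [hα]
    refine mul_le_mul_of_nonneg_left ?_ (sq_nonneg _)
    by_cases ho : SearchOpen x (hitBlocks (h ∘ Sum.inl))
    · rw [if_pos ho]
      split_ifs <;> norm_num
    · rw [if_neg ho, if_neg]
      rw [Set.mem_singleton_iff]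
      split_ifs with h1 h2
      · simp
      · simp
      · push Not at h2
        obtain ⟨j, hj⟩ := h2
        refine absurd ⟨h1, j, ?_⟩ ho
        rw [← (hsupp x h hα).2 j]
        simpa using hj
  · rw [hA]
    refine Finset.sum_eq_zero fun h _ => ?_
    by_cases hα : α x h = 0
    · simp [hα]
    rw [if_neg, mul_zero]
    rw [Set.mem_singleton_iff]
    obtain ⟨s1, s2⟩ := hsupp x h hα
    split_ifs with h1 h2
    · have := andOfOrs_eq_true_of_hitBlocks (u := h ∘ Sum.inl) s1 h1
      simp [this]
    · have : andOfOrs m (m ^ 2) x = false := by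
        rw [andOfOrs, decide_eq_false_iff_not]
        intro hall
        obtain ⟨j, hj⟩ := hall (targetBlock (hitBlocks (h ∘ Sum.inl)))
        rw [← s2 j, h2 j] at hj
        exact Bool.noConfusion hj
      simp [this]
    · simp

/-- The set is chosen before `x`, from the records alone, since the output rule cannot depend on the
input. -/
theorem exists_certificate {m b n : ℕ} [Nonempty (Fin m)] (hmb : m ≤ b)
    (u : Fin n → (Fin m × Fin b) × Bool) :
    ∃ S : Finset (Fin m × Fin b), S.card ≤ b ∧ ∀ x, (∀ t, (u t).2 = x (u t).1) →
      ¬ SearchOpen x (hitBlocks u) → IsCertificate (andOfOrs m b) x S := by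
  classical
  by_cases hF : hitBlocks u = Finset.univ
  · have hex : ∀ i, ∃ q, (u q).2 = true ∧ (u q).1.1 = i := fun i =>
      (Finset.mem_filter.1 (hF ▸ Finset.mem_univ i : i ∈ hitBlocks u)).2
    choose q hq1 hq2 using hex
    refine ⟨Finset.univ.image fun i => (u (q i)).1, ?_, fun x hx _ y hy => ?_⟩
    · refine Finset.card_image_le.trans ?_
      simpa using hmb
    · rw [andOfOrs_eq_true_of_hitBlocks hx hF, andOfOrs, decide_eq_true_iff]
      intro i
      refine ⟨(u (q i)).1.2, ?_⟩
      have h1 := hy (u (q i)).1 (Finset.mem_image_of_mem _ (Finset.mem_univ i))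
      rw [← hx, hq1] at h1
      rw [← h1]
      congr 1
      exact Prod.ext (hq2 i).symm rfl
  · refine ⟨Finset.univ.image fun j => (targetBlock (hitBlocks u), j), ?_, fun x hx ho y hy => ?_⟩
    · refine Finset.card_image_le.trans ?_
      simp
    · have hzero : ∀ z : Fin m × Fin b → Bool,
          (∀ j, z (targetBlock (hitBlocks u), j) = x (targetBlock (hitBlocks u), j)) →
          andOfOrs m b z = false := by
        intro z hz
        rw [andOfOrs, decide_eq_false_iff_not]
        intro hall
        obtain ⟨j, hj⟩ := hall (targetBlock (hitBlocks u))
        exact ho ⟨hF, j, by rw [← hz, hj]⟩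
      rw [hzero x fun _ => rfl, hzero y fun j => hy _ (Finset.mem_image_of_mem _ (Finset.mem_univ j))]

theorem exists_selfCertifying {m : ℕ} (hm : 0 < m) :
    ∃ A : QuantumQueryAlgorithm (Fin m × Fin (m ^ 2)) (Finset (Fin m × Fin (m ^ 2))),
      A.SelfCertifying (andOfOrs m (m ^ 2)) (m ^ 2) ∧ A.queries ≤ 199 * m ^ 2 := by
  classical
  have : Nonempty (Fin m) := ⟨⟨0, hm⟩⟩
  obtain ⟨n, T, p₀, α, hT, hr, hsupp, hopen⟩ := exists_search hm
  choose S hScard hS using exists_certificate (n := n) (Nat.le_self_pow two_ne_zero m)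
  obtain ⟨A, hAT, hout, hA⟩ := exists_algorithm_of_reach hr fun h => S (h ∘ Sum.inl)
  refine ⟨A, ⟨fun s => ?_, fun x => ?_⟩, hAT.trans_le hT⟩
  · obtain ⟨z, hz⟩ := hout s
    rw [hz]
    exact hScard _
  · have htotal := sum_norm_sq_of_reach hr x
    have hle : ∑ h, ‖α x h‖ ^ 2 - ∑ h, ‖α x h‖ ^ 2 *
        (if SearchOpen x (hitBlocks (h ∘ Sum.inl)) then 1 else 0) ≤
        A.prob x {S | IsCertificate (andOfOrs m (m ^ 2)) x S} := by
      rw [hA, ← Finset.sum_sub_distrib]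
      refine Finset.sum_le_sum fun h _ => ?_
      by_cases hα : α x h = 0
      · simp [hα]
      by_cases ho : SearchOpen x (hitBlocks (h ∘ Sum.inl))
      · rw [if_pos ho, mul_one, sub_self]
        exact mul_nonneg (sq_nonneg _) (by split_ifs <;> norm_num)
      · rw [if_neg ho, if_pos (show _ ∈ {S | IsCertificate (andOfOrs m (m ^ 2)) x S} from
          hS (h ∘ Sum.inl) x (hsupp x h hα).1 ho)]
        simp
    linarith [hopen x]

theorem mainTheorem8 :
    ∃ c C : ℝ, 0 < c ∧ 0 < C ∧ ∀ N m : ℕ, 0 < N → N = m ^ 3 →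
      (c * (N : ℝ) ^ (2 / 3 : ℝ) ≤ (zeroErrorQuantumComplexity (andOfOrs m (m ^ 2)) : ℝ) ∧
        (zeroErrorQuantumComplexity (andOfOrs m (m ^ 2)) : ℝ) ≤ C * (N : ℝ) ^ (2 / 3 : ℝ)) ∧
      (c * (N : ℝ) ^ (2 / 3 : ℝ) ≤ (selfCertifyingQuantumComplexity (andOfOrs m (m ^ 2)) : ℝ) ∧
        (selfCertifyingQuantumComplexity (andOfOrs m (m ^ 2)) : ℝ) ≤
          C * (N : ℝ) ^ (2 / 3 : ℝ)) ∧
      c * (N : ℝ) ≤ (boundedErrorClassicalComplexity (andOfOrs m (m ^ 2)) : ℝ) := by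
  -- The smallest lower constant is the classical `1/6`; `200` is `199` for the search plus `1` for
  -- the classical verification of `m ^ 2` variables.
  refine ⟨1 / 6, 200, by norm_num, by norm_num, fun N m hN hNm => ?_⟩
  have hm : 0 < m := Nat.pos_of_ne_zero fun h => by
    rw [h, zero_pow three_ne_zero] at hNm
    omega
  have hb : 0 < m ^ 2 := by positivity
  have hpow : (N : ℝ) ^ (2 / 3 : ℝ) = ((m ^ 2 : ℕ) : ℝ) := by
    rw [hNm]
    push_cast
    rw [← Real.rpow_natCast, ← Real.rpow_mul (Nat.cast_nonneg m)]
    norm_num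
  rw [hpow]
  obtain ⟨A, hA, hAT⟩ := exists_zeroError hm
  obtain ⟨B, hB, hBT⟩ := exists_selfCertifying hm
  refine ⟨⟨?_, ?_⟩, ⟨?_, ?_⟩, ?_⟩
  · obtain ⟨A', hA', hT⟩ := Nat.sInf_mem (s := {T | ∃ A : QuantumQueryAlgorithm
      (Fin m × Fin (m ^ 2)) (Option Bool), A.ZeroError (andOfOrs m (m ^ 2)) ∧ A.queries = T})
      ⟨_, A, hA, rfl⟩
    have h := le_queries_of_zeroError hm hb A' hA'
    rw [hT] at h
    have h2 : ((m ^ 2 : ℕ) : ℝ) ≤ 2 * zeroErrorQuantumComplexity (andOfOrs m (m ^ 2)) := by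
      exact_mod_cast h
    have h3 : (0 : ℝ) ≤ ((m ^ 2 : ℕ) : ℝ) := Nat.cast_nonneg _
    linarith
  · have h : zeroErrorQuantumComplexity (andOfOrs m (m ^ 2)) ≤ 200 * m ^ 2 :=
      (Nat.sInf_le (m := A.queries) (by exact ⟨A, hA, rfl⟩)).trans (by omega)
    exact_mod_cast h
  · obtain ⟨B', k, hB', hT⟩ := Nat.sInf_mem (s := {T | ∃ (A : QuantumQueryAlgorithm
      (Fin m × Fin (m ^ 2)) (Finset (Fin m × Fin (m ^ 2)))) (k : ℕ),
      A.SelfCertifying (andOfOrs m (m ^ 2)) k ∧ A.queries + k = T}) ⟨_, B, _, hB, rfl⟩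
    have h := (le_of_selfCertifying hm B' hB').trans (Nat.le_add_left k B'.queries)
    rw [hT] at h
    have h2 : ((m ^ 2 : ℕ) : ℝ) ≤ selfCertifyingQuantumComplexity (andOfOrs m (m ^ 2)) := by
      exact_mod_cast h
    have h3 : (0 : ℝ) ≤ ((m ^ 2 : ℕ) : ℝ) := Nat.cast_nonneg _
    linarith
  · have h : selfCertifyingQuantumComplexity (andOfOrs m (m ^ 2)) ≤ 200 * m ^ 2 :=
      (Nat.sInf_le (m := B.queries + m ^ 2) (by exact ⟨B, _, hB, rfl⟩)).trans (by omega)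
    exact_mod_cast h
  · have h := boundedErrorClassicalComplexity_andOfOrs_ge (a := m) hb
    have h2 : (N : ℝ) ≤ m * (((m ^ 2 : ℕ) : ℝ) + 1) := by
      rw [hNm]
      push_cast
      nlinarith [(Nat.cast_nonneg m : (0 : ℝ) ≤ m)]
    linarith
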